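/- **Setting.** Let $\|\cdot\|$ be the Euclidean norm of vectors and the operator norm of matrices, and $\preceq$ the Loewner order of symmetric matrices. Consider, for $T>0$ and $x_0\in\mathbb R^{n_x}$, the linear-quadratic problem $$\min_{u,x}\ \tfrac12\int_0^T\big(x^\top Qx+2u^\top Hx+u^\top Ru\big)\,dt+\tfrac12x(T)^\top Q_Tx(T)\quad\text{s.t. }\dot x=Ax+Bu \text{ on } (0,T],\quad x(0)=x_0,$$ over bounded controls $u$, where $A,B,Q,H,R$ are continuous matrix functions on $[0,T]$. Let $\Phi_A(t,s)$ be the evolution operator of $\dot x=A(t)x$ and $W(t_0,t_1)=\int_{t_0}^{t_1}\Phi_A(t_0,s)B(s)B(s)^\top\Phi_A(t_0,s)^\top ds$. Assume: 1. $\|A\|\le\lambda_A$, $\|B\|\le\lambda_B$, $\|Q\|\le\lambda_Q$, $\|H\|\le\lambda_H$, $\|R\|\le\lambda_R$ on $[0,T]$, with positive constants; 2. there are $\sigma\in(0,T)$ and $\alpha_0,\alpha_1,\beta_0,\beta_1>0$ such that for every $t_0\in[0,T-\sigma]$ there is $t_1\in[t_0,t_0+\sigma]$ with $\alpha_0I\preceq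 W(t_0,t_1)\preceq\alpha_1I$ and $\beta_0I\preceq\Phi_A(t_1,t_0)W(t_0,t_1)\Phi_A(t_1,t_0)^\top\preceq\beta_1I$; 3. $R\succeq\gamma_RI$ and $Q-H^\top R^{-1}H\succeq\gamma_QI$ on $[0,T]$, and $\gamma_QI\preceq Q_T\preceq\lambda_QI$, with $\gamma_R>0$ and $\lambda_Q\ge\gamma_Q>0$. For this problem and for the subproblems below, a solution $(x,u,\lambda)$ on $[a,b]$ with terminal cost $L$ consists of an optimal pair $(x,u)$ with $u$ continuous and the adjoint $\lambda$, i.e. $\dot\lambda=-Qx-H^\top u-A^\top\lambda$ on $[a,b]$, $\lambda(b)=\nabla L(x(b))$. Let $(x^*,u^*,\lambda^*)$ be the solution of the full problem. **Schwarz iteration.** Let $0=t_0<t_1<\dots<t_m=T$, $\tau_j^0,\tau_j^1>0$, $t_j^0=\max\{t_{j-1}-\tau_j^0,0\}$, $t_j^1=\min\{t_j+\tau_j^1,T\}$ for $1\le j\le m$, and $\tau=\min_j\min\{\tau_j^0,\tau_j^1\}$. Let $(x^{(0)},u^{(0)},\lambda^{(0)})$ be any functions on $[0,T]$ with $x^{(0)}(0)=x_0$.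 For $k\ge1$ and $1\le j\le m$ let $p=x^{(k-1)}(t_j^0)$, $q=x^{(k-1)}(t_j^1)-Q(t_j^1)^{-1}\lambda^{(k-1)}(t_j^1)$, and let $(x^{(k)}_j,u^{(k)}_j,\lambda^{(k)}_j)$ be the solution on $[t_j^0,t_j^1]$ of the problem of minimizing $$\tfrac12\int_{t_j^0}^{t_j^1}\big(x^\top Qx+2u^\top Hx+u^\top Ru\big)\,dt+L_j(x(t_j^1))\quad\text{s.t. }\dot x=Ax+Bu,\quad x(t_j^0)=p,$$ where $L_j(z)=\tfrac12z^\top Q(t_j^1)z-z^\top Q(t_j^1)q$ if $j<m$ and $L_m(z)=\tfrac12z^\top Q_Tz$. The iterate $(x^{(k)},u^{(k)},\lambda^{(k)})$ is defined to be $(x_j^{(k)},u_j^{(k)},\lambda_j^{(k)})$ on $[t_{j-1},t_j)$ if $j<m$ and on $[t_{m-1},t_m]$ if $j=m$. **Constants.** Put $a=\lambda_A+\lambda_B\lambda_H/\gamma_R$ and $$\alpha_1'=\frac{\lambda_B^2(e^{2a\sigma}-1)}{2a},\qquad \alpha_0'=\Big(\frac2{\alpha_0}+\frac{\lambda_H^2}{\gamma_R^2\lambda_A}\Big(1+\frac{\alpha_1}{\alpha_0}\Big)^2(e^{2\lambda_A\sigma}-1)\Big)^{-1},$$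 $$\tilde\alpha_0=\frac{1-e^{-2a\sigma}}{2a},\qquad \tilde\alpha_1=\frac{e^{2a\sigma}-1}{2a},$$ $$c_0=\min\Big\{2a\Big(\frac{\lambda_B^2}{\gamma_R}\Big(1+\frac{\tilde\alpha_1}{\tilde\alpha_0}\Big)^2+\frac1{\gamma_Q\tilde\alpha_0^2}\Big)^{-1},\Big(\frac{\lambda_B^2}{2\gamma_Ra}+\frac1{\gamma_Q}\Big)^{-1}\Big\}e^{-2a\sigma},$$ $$c_1=\max\Big\{\Big(\Big(\lambda_Q+\frac{\lambda_H^2}{\gamma_R}\Big)\Big(1+\frac{\alpha_1'}{\alpha_0'}\Big)^2+\frac{\lambda_R\lambda_B^2}{\alpha_0'^2}\Big)\frac1{2a},\Big(\lambda_Q+\frac{\lambda_H^2}{\gamma_R}\Big)\Big(1+\frac1{2a}\Big)\Big\}e^{2a\sigma},$$ $$c_Z=\sqrt{c_1/c_0},\qquad \rho_Z(\sigma)=\frac{\gamma_Q}{2c_1},$$ $$\Lambda_b=\Big\{1+\frac{\lambda_H}{\gamma_R}+\Big(1+\frac{\lambda_B}{\gamma_R}\Big)(c_1+\lambda_Q)\Big\}\max\Big\{c_Z,\frac{c_Z^2\lambda_B^2\lambda_Q}{2\rho_Z(\sigma)\gamma_R}\Big\},\qquad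 c(\sigma)=\Lambda_b\Big(1+\frac1{\gamma_Q}\Big).$$ **Claim.** Let $k\ge1$ and let $1\le j\le m$ be such that $j=m$ or $t_j+\tau\le T$. Then for all $t\in[t_{j-1},t_j]$ $$\|x_j^{(k)}(t)-x^*(t)\|+\|u_j^{(k)}(t)-u^*(t)\|+\|\lambda_j^{(k)}(t)-\lambda^*(t)\|\le c(\sigma)e^{-\rho_Z(\sigma)\tau}\,E_j^{(k-1)},$$ where $$E_j^{(k-1)}=\|x^{(k-1)}(t_j^0)-x^*(t_j^0)\|+\big\{\|x^{(k-1)}(t_j^1)-x^*(t_j^1)\|+\|\lambda^{(k-1)}(t_j^1)-\lambda^*(t_j^1)\|\big\}\mathbf 1_{j\ne m}.$$ In particular, $\|x^{(k)}(t)-x^*(t)\|+\|u^{(k)}(t)-u^*(t)\|+\|\lambda^{(k)}(t)-\lambda^*(t)\|\le c(\sigma)e^{-\rho_Z(\sigma)\tau}E_j^{(k-1)}$ for all $t\in[t_{j-1},t_j)$ if $j<m$, and for all $t\in[t_{m-1},t_m]$ if $j=m$. -/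

import Mathlib

open Set MeasureTheory

noncomputable section

namespace Schwarz

/-- `ℝⁿ` with the `ℓ₂` norm.  A real `p × q` matrix is represented by the linear map
`Vec q →L[ℝ] Vec p`; its norm is the operator norm, its transpose is the adjoint, and `≤` between
square matrices is the Loewner order (the difference is symmetric positive semidefinite). -/
abbrev Vec (n : ℕ) : Type := EuclideanSpace ℝ (Fin n)

/-! ### Evolution operator and controllability Gramian -/

/-- Terms of the Peano–Baker series: `I₀(t,s) = I`, `Iₙ₊₁(t,s) = ∫ₛᵗ A(r) Iₙ(r,s) dr`. -/
def peanoBaker {n : ℕ} (A : ℝ → Vec n →L[ℝ] Vec n) : ℕ → ℝ → ℝ → (Vec n →L[ℝ] Vec n)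
  | 0, _, _ => 1
  | i + 1, t, s => ∫ r in s..t, A r ∘L peanoBaker A i r s

/-- The evolution operator `Φ_A(t,s)` of `ẋ(t) = A(t) x(t)`, that is `∂ₜ Φ_A(t,s) = A(t) Φ_A(t,s)`,
`Φ_A(s,s) = I`, given by the Peano–Baker series (convergent for continuous `A`). -/
def evolution {n : ℕ} (A : ℝ → Vec n →L[ℝ] Vec n) (t s : ℝ) : Vec n →L[ℝ] Vec n :=
  ∑' i, peanoBaker A i t s

/-- Controllability Gramian
`W_{A,B}(t₀,t₁) = ∫_{t₀}^{t₁} Φ_A(t₀,s) B(s) B(s)ᵀ Φ_A(t₀,s)ᵀ ds`. -/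
def gramian {n l : ℕ} (A : ℝ → Vec n →L[ℝ] Vec n) (B : ℝ → Vec l →L[ℝ] Vec n) (t₀ t₁ : ℝ) :
    Vec n →L[ℝ] Vec n :=
  ∫ s in t₀..t₁, (evolution A t₀ s ∘L B s) ∘L (evolution A t₀ s ∘L B s).adjoint

/-! ### The linear-quadratic optimal control problem -/

/-- Data of the linear-quadratic problem on `[0, T]`; only the values of the matrix functions on
`[0, T]` matter. -/
structure Problem (nx nu : ℕ) where
  T : ℝ
  A : ℝ → Vec nx →L[ℝ] Vec nx
  B : ℝ → Vec nu →L[ℝ] Vec nx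
  Q : ℝ → Vec nx →L[ℝ] Vec nx
  H : ℝ → Vec nx →L[ℝ] Vec nu
  R : ℝ → Vec nu →L[ℝ] Vec nu
  QT : Vec nx →L[ℝ] Vec nx
  x₀ : Vec nx

/-- The constants that occur in the assumptions. -/
structure Constants where
  lamA : ℝ
  lamB : ℝ
  lamQ : ℝ
  lamH : ℝ
  lamR : ℝ
  gamR : ℝ
  gamQ : ℝ
  σ : ℝ
  α₀ : ℝ
  α₁ : ℝ
  β₀ : ℝ
  β₁ : ℝ

/-- Continuity and boundedness of the problem matrices. -/
structure BoundedMatrices {nx nu : ℕ} (P : Problem nx nu) (K : Constants) : Prop where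
  lamA_pos : 0 < K.lamA
  lamB_pos : 0 < K.lamB
  lamQ_pos : 0 < K.lamQ
  lamH_pos : 0 < K.lamH
  lamR_pos : 0 < K.lamR
  contA : ContinuousOn P.A (Icc 0 P.T)
  contB : ContinuousOn P.B (Icc 0 P.T)
  contQ : ContinuousOn P.Q (Icc 0 P.T)
  contH : ContinuousOn P.H (Icc 0 P.T)
  contR : ContinuousOn P.R (Icc 0 P.T)
  normA : ∀ t ∈ Icc 0 P.T, ‖P.A t‖ ≤ K.lamA
  normB : ∀ t ∈ Icc 0 P.T, ‖P.B t‖ ≤ K.lamB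
  normQ : ∀ t ∈ Icc 0 P.T, ‖P.Q t‖ ≤ K.lamQ
  normH : ∀ t ∈ Icc 0 P.T, ‖P.H t‖ ≤ K.lamH
  normR : ∀ t ∈ Icc 0 P.T, ‖P.R t‖ ≤ K.lamR

/-- Uniform complete controllability of the pair `(A, B)`. -/
structure UniformlyControllable {nx nu : ℕ} (P : Problem nx nu) (K : Constants) : Prop where
  σ_pos : 0 < K.σ
  σ_lt : K.σ < P.T
  α₀_pos : 0 < K.α₀
  α₁_pos : 0 < K.α₁
  β₀_pos : 0 < K.β₀
  β₁_pos : 0 < K.β₁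
  bounds : ∀ t₀ ∈ Icc 0 (P.T - K.σ), ∃ t₁ ∈ Icc t₀ (t₀ + K.σ),
    K.α₀ • (1 : Vec nx →L[ℝ] Vec nx) ≤ gramian P.A P.B t₀ t₁ ∧
    gramian P.A P.B t₀ t₁ ≤ K.α₁ • (1 : Vec nx →L[ℝ] Vec nx) ∧
    K.β₀ • (1 : Vec nx →L[ℝ] Vec nx) ≤
      evolution P.A t₁ t₀ ∘L gramian P.A P.B t₀ t₁ ∘L (evolution P.A t₁ t₀).adjoint ∧
    evolution P.A t₁ t₀ ∘L gramian P.A P.B t₀ t₁ ∘L (evolution P.A t₁ t₀).adjoint ≤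
      K.β₁ • (1 : Vec nx →L[ℝ] Vec nx)

/-- Coercivity of the cost. -/
structure Coercive {nx nu : ℕ} (P : Problem nx nu) (K : Constants) : Prop where
  gamR_pos : 0 < K.gamR
  gamQ_pos : 0 < K.gamQ
  gamQ_le : K.gamQ ≤ K.lamQ
  lowerR : ∀ t ∈ Icc 0 P.T, K.gamR • (1 : Vec nu →L[ℝ] Vec nu) ≤ P.R t
  lowerQ : ∀ t ∈ Icc 0 P.T, K.gamQ • (1 : Vec nx →L[ℝ] Vec nx) ≤
    P.Q t - (P.H t).adjoint ∘L (P.R t).inverse ∘L P.H t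
  lowerQT : K.gamQ • (1 : Vec nx →L[ℝ] Vec nx) ≤ P.QT
  upperQT : P.QT ≤ K.lamQ • (1 : Vec nx →L[ℝ] Vec nx)

/-- `(x, u)` is admissible on `[a, b]` with initial state `p`: the control is bounded (and
measurable), and `x` is the continuous solution of `ẋ = A x + B u`, `x(a) = p`, in integrated
form. -/
structure Admissible {nx nu : ℕ} (P : Problem nx nu) (a b : ℝ) (p : Vec nx)
    (x : ℝ → Vec nx) (u : ℝ → Vec nu) : Prop where
  measurable_control : AEStronglyMeasurable u (volume.restrict (Icc a b))
  bounded_control : ∃ M : ℝ, ∀ t ∈ Icc a b, ‖u t‖ ≤ M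
  continuous_state : ContinuousOn x (Icc a b)
  dynamics : ∀ t ∈ Icc a b, x t = p + ∫ s in a..t, (P.A s (x s) + P.B s (u s))

/-- Bolza cost on `[a, b]` with terminal cost `L`. -/
def cost {nx nu : ℕ} (P : Problem nx nu) (a b : ℝ) (L : Vec nx → ℝ)
    (x : ℝ → Vec nx) (u : ℝ → Vec nu) : ℝ :=
  (1 / 2) * (∫ t in a..b, (inner ℝ (x t) (P.Q t (x t)) + 2 * inner ℝ (u t) (P.H t (x t))
    + inner ℝ (u t) (P.R t (u t)))) + L (x b)

/-- `(x, u, lam)` is the optimal state, control and adjoint of the problem of minimizing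
`cost P a b L` over the admissible pairs with initial state `p`.  The optimal control is the
continuous one; the adjoint solves the costate equation `λ̇ = -∇ₓℋ = -(Q x + Hᵀ u + Aᵀ λ)`,
`λ(b) = ∇L(x(b))`. -/
structure IsSolution {nx nu : ℕ} (P : Problem nx nu) (a b : ℝ) (p : Vec nx) (L : Vec nx → ℝ)
    (x : ℝ → Vec nx) (u : ℝ → Vec nu) (lam : ℝ → Vec nx) : Prop where
  admissible : Admissible P a b p x u
  optimal : ∀ x' u', Admissible P a b p x' u' → cost P a b L x u ≤ cost P a b L x' u'
  continuous_control : ContinuousOn u (Icc a b)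
  adjoint_eq : ∀ t ∈ Icc a b, HasDerivWithinAt lam
    (-(P.Q t (x t) + (P.H t).adjoint (u t) + (P.A t).adjoint (lam t))) (Icc a b) t
  adjoint_end : HasGradientAt L (lam b) (x b)

/-- Terminal cost `½ xᵀ Q_T x` of the full problem. -/
def fullTerminalCost {nx nu : ℕ} (P : Problem nx nu) (z : Vec nx) : ℝ :=
  (1 / 2) * inner ℝ z (P.QT z)

/-- `(x, u, lam)` solves the full problem on `[0, T]`. -/
def IsFullSolution {nx nu : ℕ} (P : Problem nx nu)
    (x : ℝ → Vec nx) (u : ℝ → Vec nu) (lam : ℝ → Vec nx) : Prop :=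
  IsSolution P 0 P.T P.x₀ (fullTerminalCost P) x u lam

/-! ### Overlapping decomposition and the Schwarz iteration -/

/-- A partition `0 = t₀ < ⋯ < t_m = T` with backward and forward overlap parameters.  The
subdomain with number `j + 1` of `1, …, m` is indexed by `j : Fin m`, so its end points are
`t j.castSucc` and `t j.succ`. -/
structure Decomposition (T : ℝ) (m : ℕ) where
  t : Fin (m + 1) → ℝ
  strictMono : StrictMono t
  t_zero : t 0 = 0
  t_last : t (Fin.last m) = T
  τ₀ : Fin m → ℝ
  τ₁ : Fin m → ℝ
  τ₀_pos : ∀ j, 0 < τ₀ j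
  τ₁_pos : ∀ j, 0 < τ₁ j

namespace Decomposition

variable {T : ℝ} {m : ℕ}

/-- Left end of the overlapping subdomain. -/
def left (D : Decomposition T m) (j : Fin m) : ℝ := max (D.t j.castSucc - D.τ₀ j) 0

/-- Right end of the overlapping subdomain. -/
def right (D : Decomposition T m) (j : Fin m) : ℝ := min (D.t j.succ + D.τ₁ j) T

/-- The smallest overlap parameter. -/
def τ (D : Decomposition T m) : ℝ := ⨅ j, min (D.τ₀ j) (D.τ₁ j)

/-- The part of `[0, T]` on which the aggregated iterate is the `j`-th piece: half-open for all
subdomains but the last. -/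
def cell (D : Decomposition T m) (j : Fin m) : Set ℝ :=
  if j.succ = Fin.last m then Icc (D.t j.castSucc) (D.t j.succ)
  else Ico (D.t j.castSucc) (D.t j.succ)

end Decomposition

/-- Terminal cost of the `j`-th subproblem with target parameter `q`. -/
def subTerminalCost {nx nu m : ℕ} (P : Problem nx nu) (D : Decomposition P.T m) (j : Fin m)
    (q z : Vec nx) : ℝ :=
  if j.succ = Fin.last m then (1 / 2) * inner ℝ z (P.QT z)
  else (1 / 2) * inner ℝ z (P.Q (D.right j) z) - inner ℝ z (P.Q (D.right j) q)

/-- `(x, u, lam)` solves the `j`-th subproblem with boundary parameters `p`, `q`. -/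
def IsSubSolution {nx nu m : ℕ} (P : Problem nx nu) (D : Decomposition P.T m) (j : Fin m)
    (p q : Vec nx) (x : ℝ → Vec nx) (u : ℝ → Vec nu) (lam : ℝ → Vec nx) : Prop :=
  IsSolution P (D.left j) (D.right j) p (subTerminalCost P D j q) x u lam

/-- A run of the overlapping Schwarz iteration: `(x k, u k, lam k)` are the aggregated iterates and
`(xs k j, us k j, lams k j)`, `k ≥ 1`, the solutions of the subproblems. -/
structure IsSchwarzRun {nx nu m : ℕ} (P : Problem nx nu) (D : Decomposition P.T m)
    (x : ℕ → ℝ → Vec nx) (u : ℕ → ℝ → Vec nu) (lam : ℕ → ℝ → Vec nx)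
    (xs : ℕ → Fin m → ℝ → Vec nx) (us : ℕ → Fin m → ℝ → Vec nu)
    (lams : ℕ → Fin m → ℝ → Vec nx) : Prop where
  init : x 0 0 = P.x₀
  solve : ∀ k j, IsSubSolution P D j (x k (D.left j))
    (x k (D.right j) - (P.Q (D.right j)).inverse (lam k (D.right j)))
    (xs (k + 1) j) (us (k + 1) j) (lams (k + 1) j)
  aggregate : ∀ k j, ∀ t ∈ D.cell j,
    x (k + 1) t = xs (k + 1) j t ∧ u (k + 1) t = us (k + 1) j t ∧
      lam (k + 1) t = lams (k + 1) j t

/-- Error at the boundary of the `j`-th subdomain: the state error at the left end, plus the state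
and adjoint errors at the right end unless `j` is the last subdomain. -/
def boundaryError {nx m : ℕ} {T : ℝ} (D : Decomposition T m) (j : Fin m)
    (x lam xStar lamStar : ℝ → Vec nx) : ℝ :=
  ‖x (D.left j) - xStar (D.left j)‖ +
    if j.succ = Fin.last m then 0
    else ‖x (D.right j) - xStar (D.right j)‖ + ‖lam (D.right j) - lamStar (D.right j)‖

/-! ### The explicit constants -/

namespace Constants

/-- Growth rate `λ_A + λ_B λ_H / γ_R` of the shifted system `A - B R⁻¹ H`. -/
def growth (K : Constants) : ℝ := K.lamA + K.lamB * (K.lamH / K.gamR)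

/-- Upper bound of the Gramian of the pair `(A - B R⁻¹ H, B)`. -/
def α₁' (K : Constants) : ℝ :=
  K.lamB ^ 2 * (Real.exp (2 * K.σ * K.growth) - 1) / (2 * K.growth)

/-- Lower bound of the Gramian of the pair `(A - B R⁻¹ H, B)`. -/
def α₀' (K : Constants) : ℝ :=
  (2 / K.α₀ + (K.lamH / K.gamR) ^ 2 / K.lamA * (1 + K.α₁ / K.α₀) ^ 2 *
    (Real.exp (2 * K.lamA * K.σ) - 1))⁻¹

/-- Lower bound of the Gramian of the dual pair `(-(A - B R⁻¹ H)ᵀ, I)`. -/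
def dualα₀ (K : Constants) : ℝ := (1 - Real.exp (-2 * K.growth * K.σ)) / (2 * K.growth)

/-- Upper bound of the Gramian of the dual pair `(-(A - B R⁻¹ H)ᵀ, I)`. -/
def dualα₁ (K : Constants) : ℝ := (Real.exp (2 * K.growth * K.σ) - 1) / (2 * K.growth)

/-- Lower bound of the Riccati matrix. -/
def c₀ (K : Constants) : ℝ :=
  min (2 * K.growth * (K.lamB ^ 2 / K.gamR * (1 + K.dualα₁ / K.dualα₀) ^ 2
        + 1 / (K.gamQ * K.dualα₀ ^ 2))⁻¹)
      (K.lamB ^ 2 / (2 * K.gamR * K.growth) + 1 / K.gamQ)⁻¹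
    * Real.exp (-2 * K.growth * K.σ)

/-- Upper bound of the Riccati matrix. -/
def c₁ (K : Constants) : ℝ :=
  max (((K.lamQ + K.lamH ^ 2 / K.gamR) * (1 + K.α₁' / K.α₀') ^ 2
        + K.lamR * K.lamB ^ 2 / K.α₀' ^ 2) * (1 / (2 * K.growth)))
      ((K.lamQ + K.lamH ^ 2 / K.gamR) * (1 + 1 / (2 * K.growth)))
    * Real.exp (2 * K.growth * K.σ)

/-- `c_Z(σ)`. -/
def cZ (K : Constants) : ℝ := √(K.c₁ / K.c₀)

/-- The decay rate `ρ_Z(σ)`. -/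
def ρZ (K : Constants) : ℝ := K.gamQ / (2 * K.c₁)

/-- `Λ_b(σ)`, for a bound `lamG` of the terminal parameter matrix. -/
def Λb (K : Constants) (lamG : ℝ) : ℝ :=
  (1 + K.lamH / K.gamR + (1 + K.lamB / K.gamR) * (K.c₁ + lamG)) *
    max K.cZ (K.cZ ^ 2 * K.lamB ^ 2 * lamG / (2 * K.ρZ * K.gamR))

/-- `c(σ) = Λ_b(σ) (1 + 1 / γ_Q)`, with `λ_G = λ_Q`. -/
def c (K : Constants) : ℝ := K.Λb K.lamQ * (1 + 1 / K.gamQ)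

end Constants

end Schwarz

end

/-!
An optimal triple is an extremal of the Pontryagin system: the control is the feedback
`u = -R⁻¹(Hx + Bᵀλ)` and `(x, λ)` solves a linear Hamiltonian system. Along an extremal with
`λ(b) = Gx(b)` and `γ_Q I ≼ G ≼ λ_Q I`, the function `⟨λ, x⟩` is twice the value function, hence a
Lyapunov function: it decreases at least at the rate `γ_Q‖x‖²`, lies above `c₀‖x‖²` because the
dynamics cannot drain the state arbitrarily fast, and below `c₁‖x‖²` because controllability
provides a control that steers the state to zero at bounded cost. Therefore `x` decays like
`c_Z exp(-ρ_Z t)`.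

The error of a subproblem is an extremal whose terminal condition is `λ(b) = Gx(b) + g`. With `S`
the Riccati matrix, the defect `λ - Sx` solves the adjoint of the closed-loop equation, so it decays
backwards from `g` at the same rate, and Duhamel's formula for `x` turns this into a bound of the
error by the boundary errors, each damped exponentially in its distance to `t`. The overlap makes
both distances at least `τ`.
-/

noncomputable section

/-! ### Linear differential equations -/

namespace LinearODE

variable {𝔸 : Type*} [NormedRing 𝔸] [NormedAlgebra ℝ 𝔸]

/-- Terms of the Peano–Baker series of `Ẏ = A Y` in a normed algebra. -/
def seriesTerm (A : ℝ → 𝔸) : ℕ → ℝ → ℝ → 𝔸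
  | 0, _, _ => 1
  | i + 1, t, s => ∫ r in s..t, A r * seriesTerm A i r s

/-- The fundamental solution of `Ẏ = A Y` with value `1` at `t = s`, as the sum of the Peano–Baker
series. -/
def fundamental (A : ℝ → 𝔸) (t s : ℝ) : 𝔸 := ∑' i, seriesTerm A i t s

variable {A : ℝ → 𝔸}

theorem continuous_seriesTerm (hA : Continuous A) (i : ℕ) (s : ℝ) :
    Continuous fun t => seriesTerm A i t s := by
  induction i with
  | zero => exact continuous_const
  | succ i ih =>
    exact intervalIntegral.continuous_primitive
      (fun a b => (hA.mul ih).intervalIntegrable a b) s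

theorem fundamental_self (s : ℝ) : fundamental A s s = 1 := by
  rw [fundamental, tsum_eq_single 0]
  · rfl
  · rintro (_ | i) hi
    · exact absurd rfl hi
    · exact intervalIntegral.integral_same

theorem norm_seriesTerm_le (hA : Continuous A) {M t s : ℝ} (hM : ∀ r ∈ uIcc s t, ‖A r‖ ≤ M)
    (i : ℕ) : ‖seriesTerm A i t s‖ ≤ ‖(1 : 𝔸)‖ * ((M * |t - s|) ^ i / i.factorial) := by
  induction i generalizing t with
  | zero => simp [seriesTerm]
  | succ i ih =>
    have hM0 : 0 ≤ M := (norm_nonneg _).trans (hM s left_mem_uIcc)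
    have integrand_le : ∀ r ∈ uIoc s t, ‖A r * seriesTerm A i r s‖ ≤
        ‖(1 : 𝔸)‖ * M ^ (i + 1) / i.factorial * |r - s| ^ i := by
      intro r hr
      have hr' : r ∈ uIcc s t := uIoc_subset_uIcc hr
      calc ‖A r * seriesTerm A i r s‖ ≤ ‖A r‖ * ‖seriesTerm A i r s‖ := norm_mul_le _ _
        _ ≤ M * (‖(1 : 𝔸)‖ * ((M * |r - s|) ^ i / i.factorial)) := by
            gcongr
            exacts [hM r hr', ih fun q hq => hM q (uIcc_subset_uIcc_left hr' hq)]
        _ = _ := by rw [mul_pow]; ring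
    calc ‖seriesTerm A (i + 1) t s‖ ≤ ∫ r in uIoc s t, ‖A r * seriesTerm A i r s‖ :=
          intervalIntegral.norm_integral_le_integral_norm_uIoc
      _ ≤ ∫ r in uIoc s t, ‖(1 : 𝔸)‖ * M ^ (i + 1) / i.factorial * |r - s| ^ i :=
          setIntegral_mono_on
            (intervalIntegrable_iff.1
              ((hA.mul (continuous_seriesTerm hA i s)).norm.intervalIntegrable s t))
            (intervalIntegrable_iff.1 (Continuous.intervalIntegrable (by fun_prop) s t))
            measurableSet_uIoc integrand_le
      _ = _ := by
          rw [integral_const_mul, integral_pow_abs_sub_uIoc, mul_pow, Nat.factorial_succ]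
          push_cast
          field_simp

theorem norm_fundamental_le (hA : Continuous A) {M t s : ℝ} (hM : ∀ r ∈ uIcc s t, ‖A r‖ ≤ M) :
    ‖fundamental A t s‖ ≤ ‖(1 : 𝔸)‖ * Real.exp (M * |t - s|) := by
  refine tsum_of_norm_bounded (HasSum.mul_left _ ?_) fun i => norm_seriesTerm_le hA hM i
  rw [Real.exp_eq_exp_ℝ]
  exact NormedSpace.expSeries_div_hasSum_exp _

variable [CompleteSpace 𝔸]

theorem summable_seriesTerm (hA : Continuous A) (t s : ℝ) :
    Summable fun i => seriesTerm A i t s := by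
  obtain ⟨M, hM⟩ := isCompact_uIcc.exists_bound_of_continuousOn (s := uIcc s t) hA.continuousOn
  exact .of_norm_bounded ((Real.summable_pow_div_factorial _).mul_left _)
    fun i => norm_seriesTerm_le hA hM i

theorem hasDerivAt_seriesTerm_succ (hA : Continuous A) (i : ℕ) (t s : ℝ) :
    HasDerivAt (fun t => seriesTerm A (i + 1) t s) (A t * seriesTerm A i t s) t :=
  ((hA.mul (continuous_seriesTerm hA i s)).integral_hasStrictDerivAt s t).hasDerivAt

theorem hasDerivAt_fundamental (hA : Continuous A) (t s : ℝ) :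
    HasDerivAt (fun t => fundamental A t s) (A t * fundamental A t s) t := by
  have hsum := summable_seriesTerm hA
  have hsplit : ∀ r, fundamental A r s = 1 + ∑' i, seriesTerm A (i + 1) r s := fun r =>
    (hsum r s).tsum_eq_zero_add
  simp only [hsplit]
  refine HasDerivAt.const_add 1 ?_
  rw [← hsplit, fundamental, ← (hsum t s).tsum_mul_left]
  set ρ : ℝ := |t - s| + 1 with hρ
  have hs : s ∈ Metric.ball s ρ := Metric.mem_ball_self (by positivity)
  have ht : t ∈ Metric.ball s ρ := by rw [Metric.mem_ball, Real.dist_eq]; simp [hρ]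
  obtain ⟨M, hM⟩ :=
    (isCompact_closedBall s ρ).exists_bound_of_continuousOn hA.continuousOn
  have hM0 : 0 ≤ M := (norm_nonneg _).trans (hM s (Metric.ball_subset_closedBall hs))
  refine hasDerivAt_tsum_of_isPreconnected
    (u := fun i : ℕ => M * (‖(1 : 𝔸)‖ * ((M * ρ) ^ i / i.factorial)))
    (((Real.summable_pow_div_factorial _).mul_left _).mul_left M) Metric.isOpen_ball
    (convex_ball s ρ).isPreconnected (fun i r _ => hasDerivAt_seriesTerm_succ hA i r s) ?_ hs
    ((summable_nat_add_iff 1).2 (hsum s s)) ht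
  intro i r hr
  have hsr : uIcc s r ⊆ Metric.closedBall s ρ :=
    ((convex_ball s ρ).ordConnected.uIcc_subset hs hr).trans Metric.ball_subset_closedBall
  have hr' : |r - s| ≤ ρ := (Metric.mem_ball.1 hr).le
  calc ‖A r * seriesTerm A i r s‖ ≤ ‖A r‖ * ‖seriesTerm A i r s‖ := norm_mul_le _ _
    _ ≤ M * (‖(1 : 𝔸)‖ * ((M * |r - s|) ^ i / i.factorial)) := by
        gcongr
        exacts [hM r (hsr right_mem_uIcc), norm_seriesTerm_le hA (fun q hq => hM q (hsr hq)) i]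
    _ ≤ M * (‖(1 : 𝔸)‖ * ((M * ρ) ^ i / i.factorial)) := by gcongr

theorem eq_fundamental_mul (hA : Continuous A) {Y : ℝ → 𝔸}
    (hY : ∀ t, HasDerivAt Y (A t * Y t) t) (t s : ℝ) : Y t = fundamental A t s * Y s := by
  obtain ⟨M, hM⟩ :=
    (isCompact_Icc (a := min s t - 1) (b := max s t + 1)).exists_bound_of_continuousOn
    hA.continuousOn
  have hlip : ∀ r ∈ Ioo (min s t - 1) (max s t + 1),
      LipschitzOnWith M.toNNReal (fun Z => A r * Z) univ := by
    refine fun r hr => (LipschitzWith.of_dist_le_mul fun Z W => ?_).lipschitzOnWith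
    have hMr : ‖A r‖ ≤ M := hM r (Ioo_subset_Icc_self hr)
    rw [Real.coe_toNNReal _ ((norm_nonneg _).trans hMr), dist_eq_norm, dist_eq_norm, ← mul_sub]
    exact (norm_mul_le _ _).trans (by gcongr)
  have hmem : ∀ r ∈ uIcc s t, r ∈ Ioo (min s t - 1) (max s t + 1) := fun r hr =>
    ⟨(sub_one_lt _).trans_le hr.1, hr.2.trans_lt (lt_add_one _)⟩
  refine ODE_solution_unique_of_mem_Ioo (v := fun r Z => A r * Z) (s := fun _ => univ)
    (g := fun r => fundamental A r s * Y s) hlip (hmem s left_mem_uIcc)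
    (fun r _ => ⟨hY r, mem_univ _⟩) (fun r _ => ⟨?_, mem_univ _⟩) ?_ (hmem t right_mem_uIcc)
  · rw [← mul_assoc]
    exact (hasDerivAt_fundamental hA r s).mul_const _
  · rw [fundamental_self, one_mul]

theorem fundamental_mul (hA : Continuous A) (t s r : ℝ) :
    fundamental A t s * fundamental A s r = fundamental A t r :=
  (eq_fundamental_mul hA (fun q => hasDerivAt_fundamental hA q r) t s).symm

theorem fundamental_mul_swap (hA : Continuous A) (t s : ℝ) :
    fundamental A t s * fundamental A s t = 1 := by
  rw [fundamental_mul hA, fundamental_self]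

theorem continuous_fundamental_left (hA : Continuous A) (s : ℝ) :
    Continuous fun t => fundamental A t s :=
  continuous_iff_continuousAt.2 fun t => (hasDerivAt_fundamental hA t s).continuousAt

theorem continuous_fundamental_right (hA : Continuous A) (t : ℝ) :
    Continuous fun s => fundamental A t s := by
  let unit (s : ℝ) : 𝔸ˣ := ⟨fundamental A s t, fundamental A t s, fundamental_mul_swap hA s t,
    fundamental_mul_swap hA t s⟩
  have hinv : (fun s => fundamental A t s) = fun s => Ring.inverse (fundamental A s t) :=
    funext fun s => (Ring.inverse_unit (unit s)).symm
  rw [hinv]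
  exact continuous_iff_continuousAt.2 fun s =>
    (NormedRing.inverse_continuousAt (unit s)).comp (f := fun s => fundamental A s t)
      (continuous_fundamental_left hA t).continuousAt

end LinearODE

namespace Schwarz

/-! ### Quadratic forms -/

section QuadraticForms

variable {E : Type*} [NormedAddCommGroup E] [InnerProductSpace ℝ E] {F : E →L[ℝ] E} {c : ℝ}

theorem smul_one_le_iff : c • (1 : E →L[ℝ] E) ≤ F ↔
    (∀ x y, inner ℝ (F x) y = inner ℝ x (F y)) ∧ ∀ x, c * ‖x‖ ^ 2 ≤ inner ℝ x (F x) := by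
  rw [ContinuousLinearMap.le_def, ContinuousLinearMap.isPositive_iff]
  refine and_congr (forall₂_congr fun x y => ?_) (forall_congr' fun x => ?_)
  · simp only [ContinuousLinearMap.coe_coe, sub_apply, smul_apply, one_apply_eq_self,
      inner_sub_left, inner_sub_right, real_inner_smul_left, real_inner_smul_right, sub_left_inj]
  · rw [real_inner_comm]
    simp only [sub_apply, smul_apply, one_apply_eq_self, inner_sub_right, real_inner_smul_right,
      real_inner_self_eq_norm_sq, sub_nonneg]

theorem inner_le_of_le_smul_one (h : F ≤ c • (1 : E →L[ℝ] E)) (x : E) :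
    inner ℝ x (F x) ≤ c * ‖x‖ ^ 2 := by
  have hpos := ((ContinuousLinearMap.le_def _ _).1 h).inner_nonneg_right x
  simpa only [sub_apply, smul_apply, one_apply_eq_self, inner_sub_right, real_inner_smul_right,
    real_inner_self_eq_norm_sq, sub_nonneg] using hpos

theorem norm_le_of_inner_le (hc : 0 ≤ c) (hsymm : ∀ x y, inner ℝ (F x) y = inner ℝ x (F y))
    (hnonneg : ∀ x, 0 ≤ inner ℝ x (F x)) (hle : ∀ x, inner ℝ x (F x) ≤ c * ‖x‖ ^ 2) :
    ‖F‖ ≤ c := by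
  rw [F.norm_eq_iSup_rayleighQuotient hsymm]
  refine Real.iSup_le (fun x => ?_) hc
  rw [ContinuousLinearMap.rayleighQuotient, ContinuousLinearMap.reApplyInnerSelf_apply,
    RCLike.re_to_real, real_inner_comm, abs_of_nonneg (div_nonneg (hnonneg x) (sq_nonneg _))]
  exact div_le_of_le_mul₀ (sq_nonneg _) hc (hle x)

theorem norm_le_of_le_inner (hc : 0 < c) (h : ∀ x, c * ‖x‖ ^ 2 ≤ inner ℝ x (F x)) (x : E) :
    ‖x‖ ≤ ‖F x‖ / c := by
  rcases (norm_nonneg x).eq_or_lt with hx | hx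
  · rw [← hx]
    positivity
  · rw [le_div_iff₀ hc]
    refine le_of_mul_le_mul_left ?_ hx
    linarith [(h x).trans (real_inner_le_norm x (F x))]

theorem isInvertible_of_le_inner [CompleteSpace E] (hc : 0 < c)
    (h : ∀ x, c * ‖x‖ ^ 2 ≤ inner ℝ x (F x)) : F.IsInvertible := by
  have hunit : IsUnit F := F.isUnit_of_forall_le_norm_inner_map (c := ⟨c, hc.le⟩) hc fun x => by
    rw [real_inner_comm, mul_comm]
    exact (h x).trans (le_abs_self _)
  obtain ⟨G, rfl⟩ := hunit
  exact .of_inverse G.mul_inv G.inv_mul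

theorem sq_norm_add_le {G : Type*} [SeminormedAddCommGroup G] (x y : G) :
    ‖x + y‖ ^ 2 ≤ 2 * ‖x‖ ^ 2 + 2 * ‖y‖ ^ 2 := by
  calc ‖x + y‖ ^ 2 ≤ (‖x‖ + ‖y‖) ^ 2 := by gcongr; exact norm_add_le x y
    _ ≤ 2 * ‖x‖ ^ 2 + 2 * ‖y‖ ^ 2 := add_sq_le.trans_eq (mul_add _ _ _)

end QuadraticForms

/-! ### Coefficients of the problem -/

section

/-- Positivity of the constants that enter the estimates. -/
structure Constants.Positive (K : Constants) : Prop where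
  lamA_pos : 0 < K.lamA
  lamB_pos : 0 < K.lamB
  lamQ_pos : 0 < K.lamQ
  lamH_pos : 0 < K.lamH
  lamR_pos : 0 < K.lamR
  gamR_pos : 0 < K.gamR
  gamQ_pos : 0 < K.gamQ
  σ_pos : 0 < K.σ
  α₀_pos : 0 < K.α₀
  α₁_pos : 0 < K.α₁

variable {nx nu : ℕ}

/-- Continuity of the coefficients on the whole real line. -/
structure ContinuousCoefficients (P : Problem nx nu) : Prop where
  contA : Continuous P.A
  contB : Continuous P.B
  contQ : Continuous P.Q
  contH : Continuous P.H
  contR : Continuous P.R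

/-- The standing assumptions on the coefficients, imposed on all of `ℝ` instead of `[0, T]`; every
problem is brought to this form by `Problem.extend`. -/
structure Regular (P : Problem nx nu) (K : Constants) : Prop
    extends K.Positive, ContinuousCoefficients P where
  normA : ∀ t, ‖P.A t‖ ≤ K.lamA
  normB : ∀ t, ‖P.B t‖ ≤ K.lamB
  normQ : ∀ t, ‖P.Q t‖ ≤ K.lamQ
  normH : ∀ t, ‖P.H t‖ ≤ K.lamH
  normR : ∀ t, ‖P.R t‖ ≤ K.lamR
  lowerR : ∀ t, K.gamR • (1 : Vec nu →L[ℝ] Vec nu) ≤ P.R t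
  lowerQ : ∀ t, K.gamQ • (1 : Vec nx →L[ℝ] Vec nx) ≤
    P.Q t - (P.H t).adjoint ∘L (P.R t).inverse ∘L P.H t

/-- The two-sided bound of the controllability Gramian in the definition of uniform complete
controllability. -/
def GramianBounds (P : Problem nx nu) (K : Constants) : Prop :=
  ∀ t₀ ∈ Icc 0 (P.T - K.σ), ∃ t₁ ∈ Icc t₀ (t₀ + K.σ),
    K.α₀ • (1 : Vec nx →L[ℝ] Vec nx) ≤ gramian P.A P.B t₀ t₁ ∧
      gramian P.A P.B t₀ t₁ ≤ K.α₁ • (1 : Vec nx →L[ℝ] Vec nx)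

/-- The running cost `xᵀQx + 2uᵀHx + uᵀRu` at time `t`. -/
def stageCost (P : Problem nx nu) (t : ℝ) (x : Vec nx) (u : Vec nu) : ℝ :=
  inner ℝ x (P.Q t x) + 2 * inner ℝ u (P.H t x) + inner ℝ u (P.R t u)

/-- The bilinear form whose quadratic form is the running cost. -/
def stagePolar (P : Problem nx nu) (t : ℝ) (x : Vec nx) (u : Vec nu) (y : Vec nx) (v : Vec nu) :
    ℝ :=
  inner ℝ y (P.Q t x + (P.H t).adjoint u) + inner ℝ v (P.H t x + P.R t u)

/-- The control `u + R⁻¹Hx` of the system with drift `A - BR⁻¹H`, in which the running cost has no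
cross term. -/
def shifted (P : Problem nx nu) (t : ℝ) (x : Vec nx) (u : Vec nu) : Vec nu :=
  u + (P.R t).inverse (P.H t x)

variable {P : Problem nx nu} {K : Constants}

theorem stagePolar_self (t : ℝ) (x : Vec nx) (u : Vec nu) :
    stagePolar P t x u x u = stageCost P t x u := by
  unfold stageCost stagePolar
  simp only [inner_add_right, ContinuousLinearMap.adjoint_inner_right,
    real_inner_comm u (P.H t x)]
  ring

namespace Constants.Positive

theorem growth_pos (hK : K.Positive) : 0 < K.growth := by
  obtain ⟨_, _, _, _, _, _, _⟩ := hK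
  unfold growth
  positivity

theorem lamA_le_growth (hK : K.Positive) : K.lamA ≤ K.growth := by
  obtain ⟨_, _, _, _, _, _, _⟩ := hK
  exact le_add_of_nonneg_right (by positivity)

end Constants.Positive

namespace Regular

theorem inner_R_symm (h : Regular P K) (t : ℝ) (u v : Vec nu) :
    inner ℝ (P.R t u) v = inner ℝ u (P.R t v) :=
  (smul_one_le_iff.1 (h.lowerR t)).1 u v

theorem le_inner_R (h : Regular P K) (t : ℝ) (u : Vec nu) :
    K.gamR * ‖u‖ ^ 2 ≤ inner ℝ u (P.R t u) :=
  (smul_one_le_iff.1 (h.lowerR t)).2 u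

theorem isInvertible_R (h : Regular P K) (t : ℝ) : (P.R t).IsInvertible :=
  isInvertible_of_le_inner h.gamR_pos (h.le_inner_R t)

theorem R_inverse_apply (h : Regular P K) (t : ℝ) (u : Vec nu) :
    P.R t ((P.R t).inverse u) = u :=
  (h.isInvertible_R t).self_apply_inverse u

theorem norm_R_inverse_apply_le (h : Regular P K) (t : ℝ) (u : Vec nu) :
    ‖(P.R t).inverse u‖ ≤ ‖u‖ / K.gamR := by
  simpa only [h.R_inverse_apply] using
    norm_le_of_le_inner h.gamR_pos (h.le_inner_R t) ((P.R t).inverse u)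

theorem continuous_R_inverse (h : Regular P K) : Continuous fun t => (P.R t).inverse :=
  continuous_iff_continuousAt.2 fun t =>
    ((h.isInvertible_R t).contDiffAt_map_inverse (n := 0)).continuousAt.comp
      h.contR.continuousAt

theorem inner_R_inverse_symm (h : Regular P K) (t : ℝ) (u v : Vec nu) :
    inner ℝ ((P.R t).inverse u) v = inner ℝ u ((P.R t).inverse v) := by
  conv_lhs => rw [← h.R_inverse_apply t v, ← h.inner_R_symm, h.R_inverse_apply]

theorem inner_R_inverse_nonneg (h : Regular P K) (t : ℝ) (u : Vec nu) :
    0 ≤ inner ℝ u ((P.R t).inverse u) := by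
  have hle := h.le_inner_R t ((P.R t).inverse u)
  rw [h.R_inverse_apply, real_inner_comm] at hle
  exact (mul_nonneg h.gamR_pos.le (sq_nonneg _)).trans hle

theorem inner_Q_symm (h : Regular P K) (t : ℝ) (x y : Vec nx) :
    inner ℝ (P.Q t x) y = inner ℝ x (P.Q t y) := by
  have hsymm := (smul_one_le_iff.1 (h.lowerQ t)).1 x y
  simp only [sub_apply, ContinuousLinearMap.comp_apply, inner_sub_left, inner_sub_right,
    ContinuousLinearMap.adjoint_inner_left,
    ContinuousLinearMap.adjoint_inner_right, h.inner_R_inverse_symm] at hsymm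
  linarith

theorem le_inner_Q_sub (h : Regular P K) (t : ℝ) (x : Vec nx) :
    K.gamQ * ‖x‖ ^ 2 ≤ inner ℝ x (P.Q t x) - inner ℝ (P.H t x) ((P.R t).inverse (P.H t x)) := by
  simpa only [sub_apply, ContinuousLinearMap.comp_apply, inner_sub_right,
    ContinuousLinearMap.adjoint_inner_right] using (smul_one_le_iff.1 (h.lowerQ t)).2 x

theorem le_inner_Q (h : Regular P K) (t : ℝ) (x : Vec nx) :
    K.gamQ * ‖x‖ ^ 2 ≤ inner ℝ x (P.Q t x) := by
  linarith [h.le_inner_Q_sub t x, h.inner_R_inverse_nonneg t (P.H t x)]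

theorem inner_Q_le (h : Regular P K) (t : ℝ) (x : Vec nx) :
    inner ℝ x (P.Q t x) ≤ K.lamQ * ‖x‖ ^ 2 := by
  refine (real_inner_le_norm _ _).trans ?_
  rw [sq, mul_left_comm]
  gcongr
  exact (P.Q t).le_of_opNorm_le (h.normQ t) x

theorem stageCost_eq (h : Regular P K) (t : ℝ) (x : Vec nx) (u : Vec nu) :
    stageCost P t x u =
      (inner ℝ x (P.Q t x) - inner ℝ (P.H t x) ((P.R t).inverse (P.H t x))) +
        inner ℝ (shifted P t x u) (P.R t (shifted P t x u)) := by
  unfold stageCost shifted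
  have hcross : inner ℝ ((P.R t).inverse (P.H t x)) (P.R t u) = inner ℝ u (P.H t x) := by
    rw [← h.inner_R_symm, h.R_inverse_apply, real_inner_comm]
  simp only [map_add, inner_add_left, inner_add_right, h.R_inverse_apply, hcross,
    real_inner_comm (P.H t x) ((P.R t).inverse (P.H t x))]
  ring

theorem le_stageCost (h : Regular P K) (t : ℝ) (x : Vec nx) (u : Vec nu) :
    K.gamQ * ‖x‖ ^ 2 + K.gamR * ‖shifted P t x u‖ ^ 2 ≤ stageCost P t x u := by
  rw [h.stageCost_eq]
  exact add_le_add (h.le_inner_Q_sub t x) (h.le_inner_R t _)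

theorem gamQ_le_stageCost (h : Regular P K) (t : ℝ) (x : Vec nx) (u : Vec nu) :
    K.gamQ * ‖x‖ ^ 2 ≤ stageCost P t x u :=
  (le_add_of_nonneg_right (mul_nonneg h.gamR_pos.le (sq_nonneg _))).trans (h.le_stageCost t x u)

theorem stageCost_nonneg (h : Regular P K) (t : ℝ) (x : Vec nx) (u : Vec nu) :
    0 ≤ stageCost P t x u :=
  (mul_nonneg h.gamQ_pos.le (sq_nonneg _)).trans (h.gamQ_le_stageCost t x u)

theorem stageCost_le (h : Regular P K) (t : ℝ) (x : Vec nx) (u : Vec nu) :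
    stageCost P t x u ≤ K.lamQ * ‖x‖ ^ 2 + K.lamR * ‖shifted P t x u‖ ^ 2 := by
  rw [h.stageCost_eq]
  gcongr
  · exact (sub_le_self _ (h.inner_R_inverse_nonneg t _)).trans (h.inner_Q_le t x)
  · refine (real_inner_le_norm _ _).trans ?_
    rw [sq, mul_left_comm]
    gcongr
    exact (P.R t).le_of_opNorm_le (h.normR t) _

theorem norm_R_inverse_H_le (h : Regular P K) (t : ℝ) (x : Vec nx) :
    ‖(P.R t).inverse (P.H t x)‖ ≤ K.lamH / K.gamR * ‖x‖ := by
  refine (h.norm_R_inverse_apply_le t _).trans ?_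
  rw [div_mul_eq_mul_div]
  exact div_le_div_of_nonneg_right ((P.H t).le_of_opNorm_le (h.normH t) x) h.gamR_pos.le

theorem norm_shifted_sq_le (h : Regular P K) (t : ℝ) (x : Vec nx) (u : Vec nu) :
    ‖shifted P t x u‖ ^ 2 ≤ 2 * ‖u‖ ^ 2 + 2 * (K.lamH / K.gamR) ^ 2 * ‖x‖ ^ 2 := by
  refine (sq_norm_add_le _ _).trans ?_
  rw [mul_assoc 2 (_ ^ 2), ← mul_pow]
  gcongr
  exact h.norm_R_inverse_H_le t x

theorem stageCost_add_smul (h : Regular P K) (t c : ℝ) (x y : Vec nx) (u v : Vec nu) :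
    stageCost P t (x + c • y) (u + c • v) =
      stageCost P t x u + 2 * c * stagePolar P t x u y v + c ^ 2 * stageCost P t y v := by
  unfold stageCost stagePolar
  simp only [map_add, map_smul, inner_add_left, inner_add_right, real_inner_smul_left,
    real_inner_smul_right, ContinuousLinearMap.adjoint_inner_right,
    real_inner_comm u (P.H t y), ← h.inner_Q_symm t x y, real_inner_comm y (P.Q t x),
    ← h.inner_R_symm t u v, real_inner_comm v (P.R t u)]
  ring

theorem two_mul_stagePolar_le (h : Regular P K) (t : ℝ) (x y : Vec nx) (u v : Vec nu) :
    2 * stagePolar P t x u y v ≤ stageCost P t x u + stageCost P t y v := by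
  have hexp := h.stageCost_add_smul t (-1) x y u v
  have hnonneg := h.stageCost_nonneg t (x + (-1 : ℝ) • y) (u + (-1 : ℝ) • v)
  linarith

end Regular

namespace Problem

/-- The problem with coefficients extended to `ℝ` by their values at the end points. -/
def extend (P : Problem nx nu) (hT : 0 ≤ P.T) : Problem nx nu where
  T := P.T
  A t := P.A (projIcc 0 P.T hT t)
  B t := P.B (projIcc 0 P.T hT t)
  Q t := P.Q (projIcc 0 P.T hT t)
  H t := P.H (projIcc 0 P.T hT t)
  R t := P.R (projIcc 0 P.T hT t)
  QT := P.QT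
  x₀ := P.x₀


variable {hT : 0 ≤ P.T} {t : ℝ}

theorem extend_A (ht : t ∈ Icc 0 P.T) : (P.extend hT).A t = P.A t := by
  simp only [extend, projIcc_of_mem hT ht]

theorem extend_B (ht : t ∈ Icc 0 P.T) : (P.extend hT).B t = P.B t := by
  simp only [extend, projIcc_of_mem hT ht]

theorem extend_Q (ht : t ∈ Icc 0 P.T) : (P.extend hT).Q t = P.Q t := by
  simp only [extend, projIcc_of_mem hT ht]

theorem extend_H (ht : t ∈ Icc 0 P.T) : (P.extend hT).H t = P.H t := by
  simp only [extend, projIcc_of_mem hT ht]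

theorem extend_R (ht : t ∈ Icc 0 P.T) : (P.extend hT).R t = P.R t := by
  simp only [extend, projIcc_of_mem hT ht]

theorem regular_extend (hbdd : BoundedMatrices P K) (hcoer : Coercive P K)
    (hctrl : UniformlyControllable P K) (hT : 0 ≤ P.T) : Regular (P.extend hT) K :=
  have hmem (t : ℝ) : (projIcc 0 P.T hT t : ℝ) ∈ Icc 0 P.T := Subtype.prop _
  have hcont : Continuous fun t => (projIcc 0 P.T hT t : ℝ) :=
    continuous_subtype_val.comp continuous_projIcc
  { hbdd, hcoer, hctrl with
    contA := hbdd.contA.comp_continuous hcont hmem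
    contB := hbdd.contB.comp_continuous hcont hmem
    contQ := hbdd.contQ.comp_continuous hcont hmem
    contH := hbdd.contH.comp_continuous hcont hmem
    contR := hbdd.contR.comp_continuous hcont hmem
    normA _ := hbdd.normA _ (hmem _)
    normB _ := hbdd.normB _ (hmem _)
    normQ _ := hbdd.normQ _ (hmem _)
    normH _ := hbdd.normH _ (hmem _)
    normR _ := hbdd.normR _ (hmem _)
    lowerR _ := hcoer.lowerR _ (hmem _)
    lowerQ _ := hcoer.lowerQ _ (hmem _) }

end Problem

theorem peanoBaker_congr {n : ℕ} {A A' : ℝ → Vec n →L[ℝ] Vec n} {c d : ℝ}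
    (h : EqOn A A' (Icc c d)) (i : ℕ) {t s : ℝ} (ht : t ∈ Icc c d) (hs : s ∈ Icc c d) :
    peanoBaker A i t s = peanoBaker A' i t s := by
  induction i generalizing t with
  | zero => rfl
  | succ i ih =>
    refine intervalIntegral.integral_congr fun r hr => ?_
    have hr' : r ∈ Icc c d := uIcc_subset_Icc hs ht hr
    simp only [h hr', ih hr']

theorem evolution_congr {n : ℕ} {A A' : ℝ → Vec n →L[ℝ] Vec n} {c d : ℝ}
    (h : EqOn A A' (Icc c d)) {t s : ℝ} (ht : t ∈ Icc c d) (hs : s ∈ Icc c d) :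
    evolution A t s = evolution A' t s :=
  tsum_congr fun i => peanoBaker_congr h i ht hs

theorem gramian_congr {n l : ℕ} {A A' : ℝ → Vec n →L[ℝ] Vec n} {B B' : ℝ → Vec l →L[ℝ] Vec n}
    {c d : ℝ} (hA : EqOn A A' (Icc c d)) (hB : EqOn B B' (Icc c d)) {t₀ t₁ : ℝ}
    (h₀ : t₀ ∈ Icc c d) (h₁ : t₁ ∈ Icc c d) : gramian A B t₀ t₁ = gramian A' B' t₀ t₁ := by
  refine intervalIntegral.integral_congr fun r hr => ?_
  have hr' : r ∈ Icc c d := uIcc_subset_Icc h₀ h₁ hr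
  simp only [hB hr', evolution_congr hA h₀ hr']

theorem UniformlyControllable.gramianBounds_extend (h : UniformlyControllable P K)
    (hT : 0 ≤ P.T) : GramianBounds (P.extend hT) K := by
  intro t₀ ht₀
  obtain ⟨t₁, ht₁, hlower, hupper, -⟩ := h.bounds t₀ ht₀
  have h₀T : t₀ + K.σ ≤ P.T := le_sub_iff_add_le.1 ht₀.2
  have hgram : gramian (P.extend hT).A (P.extend hT).B t₀ t₁ = gramian P.A P.B t₀ t₁ :=
    gramian_congr (fun _ => Problem.extend_A) (fun _ => Problem.extend_B)
      ⟨ht₀.1, (le_add_of_nonneg_right h.σ_pos.le).trans h₀T⟩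
      ⟨ht₀.1.trans ht₁.1, ht₁.2.trans h₀T⟩
  exact ⟨t₁, ht₁, hgram ▸ hlower, hgram ▸ hupper⟩

section ExtendSolution

variable {hT : 0 ≤ P.T} {a b : ℝ}

theorem admissible_extend_iff (ha : 0 ≤ a) (hb : b ≤ P.T) {p : Vec nx} {x : ℝ → Vec nx}
    {u : ℝ → Vec nu} :
    Admissible (P.extend hT) a b p x u ↔ Admissible P a b p x u := by
  have hint : ∀ t ∈ Icc a b, (∫ s in a..t, ((P.extend hT).A s (x s) + (P.extend hT).B s (u s))) =
      ∫ s in a..t, (P.A s (x s) + P.B s (u s)) := by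
    refine fun t ht => intervalIntegral.integral_congr fun s hs => ?_
    rw [uIcc_of_le ht.1] at hs
    have hs' : s ∈ Icc 0 P.T := ⟨ha.trans hs.1, (hs.2.trans ht.2).trans hb⟩
    simp only [Problem.extend_A hs', Problem.extend_B hs']
  exact ⟨fun ⟨hmeas, hbdd, hcont, hdyn⟩ => ⟨hmeas, hbdd, hcont, fun t ht => hint t ht ▸ hdyn t ht⟩,
    fun ⟨hmeas, hbdd, hcont, hdyn⟩ => ⟨hmeas, hbdd, hcont, fun t ht => hint t ht ▸ hdyn t ht⟩⟩

theorem cost_extend (ha : 0 ≤ a) (hab : a ≤ b) (hb : b ≤ P.T) (L : Vec nx → ℝ) (x : ℝ → Vec nx)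
    (u : ℝ → Vec nu) :
    cost (P.extend hT) a b L x u = cost P a b L x u := by
  unfold cost
  congr 2
  refine intervalIntegral.integral_congr fun s hs => ?_
  rw [uIcc_of_le hab] at hs
  have hs' : s ∈ Icc 0 P.T := ⟨ha.trans hs.1, hs.2.trans hb⟩
  simp only [Problem.extend_Q hs', Problem.extend_H hs', Problem.extend_R hs']

theorem IsSolution.extend (ha : 0 ≤ a) (hab : a ≤ b) (hb : b ≤ P.T) {p : Vec nx}
    {L : Vec nx → ℝ} {x : ℝ → Vec nx} {u : ℝ → Vec nu} {lam : ℝ → Vec nx}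
    (h : IsSolution P a b p L x u lam) :
    IsSolution (P.extend hT) a b p L x u lam where
  admissible := (admissible_extend_iff ha hb).2 h.admissible
  optimal x' u' h' := by
    rw [cost_extend ha hab hb, cost_extend ha hab hb]
    exact h.optimal x' u' ((admissible_extend_iff ha hb).1 h')
  continuous_control := h.continuous_control
  adjoint_eq t ht := by
    have ht' : t ∈ Icc 0 P.T := ⟨ha.trans ht.1, ht.2.trans hb⟩
    rw [Problem.extend_Q ht', Problem.extend_H ht', Problem.extend_A ht']
    exact h.adjoint_eq t ht
  adjoint_end := h.adjoint_end

end ExtendSolution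

end

/-! ### Trajectories and Pontryagin's principle -/

section

section Evolution

variable {n : ℕ} {A : ℝ → Vec n →L[ℝ] Vec n}

theorem peanoBaker_eq_seriesTerm (A : ℝ → Vec n →L[ℝ] Vec n) (i : ℕ) (t s : ℝ) :
    peanoBaker A i t s = LinearODE.seriesTerm A i t s := by
  induction i generalizing t with
  | zero => rfl
  | succ i ih => exact intervalIntegral.integral_congr fun r _ => by simp only [ih]; rfl

theorem evolution_eq_fundamental (A : ℝ → Vec n →L[ℝ] Vec n) :
    evolution A = LinearODE.fundamental A :=
  funext₂ fun t s => tsum_congr fun i => peanoBaker_eq_seriesTerm A i t s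

theorem evolution_self (A : ℝ → Vec n →L[ℝ] Vec n) (s : ℝ) : evolution A s s = 1 := by
  rw [evolution_eq_fundamental, LinearODE.fundamental_self]

theorem hasDerivAt_evolution (hA : Continuous A) (t s : ℝ) :
    HasDerivAt (fun t => evolution A t s) (A t ∘L evolution A t s) t := by
  rw [evolution_eq_fundamental]
  exact LinearODE.hasDerivAt_fundamental hA t s

theorem evolution_apply_swap (hA : Continuous A) (t s : ℝ) (x : Vec n) :
    evolution A t s (evolution A s t x) = x := by
  rw [evolution_eq_fundamental]
  exact DFunLike.congr_fun (LinearODE.fundamental_mul_swap hA t s) x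

theorem continuous_evolution_right (hA : Continuous A) (t : ℝ) :
    Continuous fun s => evolution A t s := by
  rw [evolution_eq_fundamental]
  exact LinearODE.continuous_fundamental_right hA t

theorem norm_evolution_le (hA : Continuous A) {M : ℝ} (hM : ∀ r, ‖A r‖ ≤ M) (t s : ℝ) :
    ‖evolution A t s‖ ≤ Real.exp (M * |t - s|) := by
  rw [evolution_eq_fundamental]
  exact (LinearODE.norm_fundamental_le hA fun r _ => hM r).trans
    (mul_le_of_le_one_left (Real.exp_pos _).le ContinuousLinearMap.norm_id_le)

theorem continuous_adjoint_comp {l : ℕ} {F : ℝ → Vec n →L[ℝ] Vec l} (hF : Continuous F) :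
    Continuous fun t => (F t).adjoint :=
  (ContinuousLinearMap.adjoint : (Vec n →L[ℝ] Vec l) ≃ₗᵢ⋆[ℝ] _).continuous.comp hF

end Evolution

theorem hasDerivWithinAt_integral_Icc {E : Type*} [NormedAddCommGroup E] [NormedSpace ℝ E]
    [CompleteSpace E] {a b t : ℝ} {f : ℝ → E} (hf : ContinuousOn f (Icc a b)) (ht : t ∈ Icc a b) :
    HasDerivWithinAt (fun t => ∫ s in a..t, f s) (f t) (Icc a b) t := by
  have : Fact (t ∈ Icc a b) := ⟨ht⟩
  exact intervalIntegral.integral_hasDerivWithinAt_right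
    ((hf.mono (Icc_subset_Icc_right ht.2)).intervalIntegrable_of_Icc ht.1)
    (hf.stronglyMeasurableAtFilter_nhdsWithin measurableSet_Icc t) (hf t ht)

theorem integral_eq_sub_of_hasDerivWithinAt_Icc {E : Type*} [NormedAddCommGroup E]
    [NormedSpace ℝ E] [CompleteSpace E] {a b : ℝ} (hab : a ≤ b) {f f' : ℝ → E}
    (hf : ∀ t ∈ Icc a b, HasDerivWithinAt f (f' t) (Icc a b) t)
    (hf' : ContinuousOn f' (Icc a b)) : ∫ t in a..b, f' t = f b - f a :=
  intervalIntegral.integral_eq_sub_of_hasDerivAt_of_le hab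
    (fun t ht => (hf t ht).continuousWithinAt)
    (fun t ht => (hf t (Ioo_subset_Icc_self ht)).hasDerivAt (Icc_mem_nhds ht.1 ht.2))
    (hf'.intervalIntegrable_of_Icc hab)

variable {nx nu : ℕ} {P : Problem nx nu} {K : Constants}

/-- The state with initial value `p` at time `a` under the control `u`, by variation of
constants. -/
def response (P : Problem nx nu) (a : ℝ) (p : Vec nx) (u : ℝ → Vec nu) (t : ℝ) : Vec nx :=
  evolution P.A t a (p + ∫ s in a..t, evolution P.A a s (P.B s (u s)))

theorem response_self (a : ℝ) (p : Vec nx) (u : ℝ → Vec nu) : response P a p u a = p := by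
  simp [response, evolution_self]

theorem hasDerivAt_response (hP : ContinuousCoefficients P) (a : ℝ) (p : Vec nx) {u : ℝ → Vec nu}
    (hu : Continuous u) (t : ℝ) :
    HasDerivAt (response P a p u) (P.A t (response P a p u t) + P.B t (u t)) t := by
  have hcont : Continuous fun s => evolution P.A a s (P.B s (u s)) :=
    (continuous_evolution_right hP.contA a).clm_apply (hP.contB.clm_apply hu)
  have hderiv := (hasDerivAt_evolution hP.contA t a).clm_apply
    ((hcont.integral_hasStrictDerivAt a t).hasDerivAt.const_add p)
  simp only [evolution_apply_swap hP.contA] at hderiv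
  exact hderiv

/-- `x` solves `ẋ = Ax + Bu` on `[a, b]` with continuous `u`; unlike in `Admissible` the state
equation is in differential form and the initial state is free. -/
structure IsTrajectory (P : Problem nx nu) (a b : ℝ) (x : ℝ → Vec nx) (u : ℝ → Vec nu) :
    Prop where
  control : ContinuousOn u (Icc a b)
  state : ∀ t ∈ Icc a b, HasDerivWithinAt x (P.A t (x t) + P.B t (u t)) (Icc a b) t

namespace IsTrajectory

variable {a b : ℝ} {x y : ℝ → Vec nx} {u v : ℝ → Vec nu}

theorem continuousOn (hx : IsTrajectory P a b x u) : ContinuousOn x (Icc a b) :=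
  fun t ht => (hx.state t ht).continuousWithinAt

theorem response (hP : ContinuousCoefficients P) (a b : ℝ) (p : Vec nx) (hu : Continuous u) :
    IsTrajectory P a b (response P a p u) u :=
  ⟨hu.continuousOn, fun t _ => (hasDerivAt_response hP a p hu t).hasDerivWithinAt⟩

theorem add_smul (hx : IsTrajectory P a b x u) (hy : IsTrajectory P a b y v) (c : ℝ) :
    IsTrajectory P a b (fun t => x t + c • y t) (fun t => u t + c • v t) where
  control := hx.control.add (hy.control.const_smul c)
  state t ht := by
    refine ((hx.state t ht).add ((hy.state t ht).const_smul c)).congr_deriv ?_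
    simp only [map_add, map_smul, smul_add]
    abel

theorem mono (hx : IsTrajectory P a b x u) {c d : ℝ} (hac : a ≤ c) (hdb : d ≤ b) :
    IsTrajectory P c d x u :=
  have hsub : Icc c d ⊆ Icc a b := Icc_subset_Icc hac hdb
  ⟨hx.control.mono hsub, fun t ht => (hx.state t (hsub ht)).mono hsub⟩

theorem continuousOn_velocity (hP : ContinuousCoefficients P) (hx : ContinuousOn x (Icc a b))
    (hu : ContinuousOn u (Icc a b)) :
    ContinuousOn (fun t => P.A t (x t) + P.B t (u t)) (Icc a b) :=
  (hP.contA.continuousOn.clm_apply hx).add (hP.contB.continuousOn.clm_apply hu)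

theorem admissible (hP : ContinuousCoefficients P) (hx : IsTrajectory P a b x u) :
    Admissible P a b (x a) x u where
  measurable_control := hx.control.aestronglyMeasurable measurableSet_Icc
  bounded_control := isCompact_Icc.exists_bound_of_continuousOn hx.control
  continuous_state := hx.continuousOn
  dynamics t ht := by
    have hxt := hx.mono le_rfl ht.2
    rw [integral_eq_sub_of_hasDerivWithinAt_Icc ht.1 hxt.state
      (continuousOn_velocity hP hxt.continuousOn hxt.control), add_sub_cancel]

end IsTrajectory

namespace Admissible

variable {a b : ℝ} {p : Vec nx} {x : ℝ → Vec nx} {u : ℝ → Vec nu}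

theorem isTrajectory (hP : ContinuousCoefficients P) (hx : Admissible P a b p x u)
    (hu : ContinuousOn u (Icc a b)) : IsTrajectory P a b x u where
  control := hu
  state t ht := ((hasDerivWithinAt_integral_Icc (IsTrajectory.continuousOn_velocity hP
    hx.continuous_state hu) ht).const_add p).congr hx.dynamics (hx.dynamics t ht)

theorem initial (hx : Admissible P a b p x u) (hab : a ≤ b) : x a = p := by
  simpa only [intervalIntegral.integral_same, add_zero] using hx.dynamics a (left_mem_Icc.2 hab)

end Admissible

section FirstVariation

variable {a b : ℝ} {x y lam : ℝ → Vec nx} {u v : ℝ → Vec nu}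

theorem continuousOn_stageCost (hP : ContinuousCoefficients P) (hx : ContinuousOn x (Icc a b))
    (hu : ContinuousOn u (Icc a b)) :
    ContinuousOn (fun t => stageCost P t (x t) (u t)) (Icc a b) :=
  ((hx.inner (hP.contQ.continuousOn.clm_apply hx)).add
    ((hu.inner (hP.contH.continuousOn.clm_apply hx)).const_mul 2)).add
    (hu.inner (hP.contR.continuousOn.clm_apply hu))

theorem continuousOn_stagePolar (hP : ContinuousCoefficients P) (hx : ContinuousOn x (Icc a b))
    (hu : ContinuousOn u (Icc a b)) (hy : ContinuousOn y (Icc a b))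
    (hv : ContinuousOn v (Icc a b)) :
    ContinuousOn (fun t => stagePolar P t (x t) (u t) (y t) (v t)) (Icc a b) :=
  (hy.inner ((hP.contQ.continuousOn.clm_apply hx).add
    ((continuous_adjoint_comp hP.contH).continuousOn.clm_apply hu))).add
    (hv.inner ((hP.contH.continuousOn.clm_apply hx).add (hP.contR.continuousOn.clm_apply hu)))

theorem cost_add_smul (h : Regular P K) (hab : a ≤ b) (L : Vec nx → ℝ)
    (hx : IsTrajectory P a b x u) (hy : IsTrajectory P a b y v) (c : ℝ) :
    cost P a b L (fun t => x t + c • y t) (fun t => u t + c • v t) =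
      (1 / 2) * ((∫ t in a..b, stageCost P t (x t) (u t)) +
        2 * c * (∫ t in a..b, stagePolar P t (x t) (u t) (y t) (v t)) +
        c ^ 2 * ∫ t in a..b, stageCost P t (y t) (v t)) + L (x b + c • y b) := by
  have int_x := (continuousOn_stageCost h.toContinuousCoefficients hx.continuousOn
    hx.control).intervalIntegrable_of_Icc (μ := volume) hab
  have int_xy := (continuousOn_stagePolar h.toContinuousCoefficients hx.continuousOn hx.control
    hy.continuousOn hy.control).intervalIntegrable_of_Icc (μ := volume) hab
  have int_y := (continuousOn_stageCost h.toContinuousCoefficients hy.continuousOn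
    hy.control).intervalIntegrable_of_Icc (μ := volume) hab
  rw [← intervalIntegral.integral_const_mul, ← intervalIntegral.integral_const_mul,
    ← intervalIntegral.integral_add int_x (int_xy.const_mul _),
    ← intervalIntegral.integral_add (int_x.add (int_xy.const_mul _)) (int_y.const_mul _)]
  simp only [← h.stageCost_add_smul]
  rfl

theorem hasDerivAt_cost_add_smul (h : Regular P K) (hab : a ≤ b) {L : Vec nx → ℝ} {g : Vec nx}
    (hx : IsTrajectory P a b x u) (hy : IsTrajectory P a b y v) (hL : HasGradientAt L g (x b)) :
    HasDerivAt (fun c : ℝ => cost P a b L (fun t => x t + c • y t) (fun t => u t + c • v t))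
      ((∫ t in a..b, stagePolar P t (x t) (u t) (y t) (v t)) + inner ℝ g (y b)) 0 := by
  have hline : HasDerivAt (fun c : ℝ => x b + c • y b) (y b) 0 := by
    simpa using ((hasDerivAt_id (0 : ℝ)).smul_const (y b)).const_add (x b)
  have hterminal : HasDerivAt (fun c : ℝ => L (x b + c • y b)) (inner ℝ g (y b)) 0 := by
    rw [← InnerProductSpace.toDual_apply_apply (𝕜 := ℝ)]
    exact hL.hasFDerivAt.comp_hasDerivAt_of_eq 0 hline (by simp)
  simp only [cost_add_smul h hab L hx hy]
  refine HasDerivAt.add ?_ hterminal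
  have hlin := ((hasDerivAt_id (0 : ℝ)).const_mul 2).mul_const
    (∫ t in a..b, stagePolar P t (x t) (u t) (y t) (v t))
  have hquad := (hasDerivAt_pow 2 (0 : ℝ)).mul_const (∫ t in a..b, stageCost P t (y t) (v t))
  refine (((hlin.const_add _).add hquad).const_mul (1 / 2 : ℝ)).congr_deriv ?_
  simp

theorem IsSolution.first_variation (h : Regular P K) (hab : a ≤ b) {p : Vec nx}
    {L : Vec nx → ℝ} (hs : IsSolution P a b p L x u lam) (hy : IsTrajectory P a b y v)
    (hya : y a = 0) :
    (∫ t in a..b, stagePolar P t (x t) (u t) (y t) (v t)) + inner ℝ (lam b) (y b) = 0 := by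
  have hx : IsTrajectory P a b x u :=
    hs.admissible.isTrajectory h.toContinuousCoefficients hs.continuous_control
  refine IsLocalMin.hasDerivAt_eq_zero (Filter.Eventually.of_forall fun c => ?_)
    (hasDerivAt_cost_add_smul h hab hx hy hs.adjoint_end)
  have hadm := (hx.add_smul hy c).admissible h.toContinuousCoefficients
  rw [hya, smul_zero, add_zero, hs.admissible.initial hab] at hadm
  simpa only [zero_smul, add_zero] using hs.optimal _ _ hadm

end FirstVariation

/-- The costate equation `λ̇ = -(Qx + Hᵀu + Aᵀλ)` on `[a, b]`. -/
def IsCostate (P : Problem nx nu) (a b : ℝ) (x : ℝ → Vec nx) (u : ℝ → Vec nu)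
    (lam : ℝ → Vec nx) : Prop :=
  ∀ t ∈ Icc a b, HasDerivWithinAt lam
    (-(P.Q t (x t) + (P.H t).adjoint (u t) + (P.A t).adjoint (lam t))) (Icc a b) t

/-- The gradient with respect to the control of the Hamiltonian of the problem. -/
def controlGradient (P : Problem nx nu) (t : ℝ) (x : Vec nx) (u : Vec nu) (lam : Vec nx) :
    Vec nu :=
  P.R t u + P.H t x + (P.B t).adjoint lam

/-- `(x, u, lam)` satisfies Pontryagin's conditions on `[a, b]`: the state equation, the costate
equation and stationarity of the Hamiltonian in the control. -/
structure IsExtremal (P : Problem nx nu) (a b : ℝ) (x : ℝ → Vec nx) (u : ℝ → Vec nu)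
    (lam : ℝ → Vec nx) : Prop where
  trajectory : IsTrajectory P a b x u
  costate : IsCostate P a b x u lam
  stationary : ∀ t ∈ Icc a b, controlGradient P t (x t) (u t) (lam t) = 0

section Pontryagin

variable {a b : ℝ} {x y lam mu : ℝ → Vec nx} {u v : ℝ → Vec nu}

theorem IsCostate.continuousOn (hlam : IsCostate P a b x u lam) : ContinuousOn lam (Icc a b) :=
  fun t ht => (hlam t ht).continuousWithinAt

theorem continuousOn_controlGradient (hP : ContinuousCoefficients P)
    (hx : ContinuousOn x (Icc a b)) (hu : ContinuousOn u (Icc a b))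
    (hlam : ContinuousOn lam (Icc a b)) :
    ContinuousOn (fun t => controlGradient P t (x t) (u t) (lam t)) (Icc a b) :=
  ((hP.contR.continuousOn.clm_apply hu).add (hP.contH.continuousOn.clm_apply hx)).add
    ((continuous_adjoint_comp hP.contB).continuousOn.clm_apply hlam)

theorem IsCostate.hasDerivWithinAt_inner (hlam : IsCostate P a b x u lam)
    (hy : IsTrajectory P a b y v) {t : ℝ} (ht : t ∈ Icc a b) :
    HasDerivWithinAt (fun t => inner ℝ (lam t) (y t))
      (inner ℝ (controlGradient P t (x t) (u t) (lam t)) (v t) -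
        stagePolar P t (x t) (u t) (y t) (v t)) (Icc a b) t := by
  refine ((hlam t ht).inner ℝ (hy.state t ht)).congr_deriv ?_
  unfold stagePolar controlGradient
  simp only [inner_add_right, inner_add_left, inner_neg_left,
    ContinuousLinearMap.adjoint_inner_left, real_inner_comm (P.R t (u t)) (v t),
    real_inner_comm (P.H t (x t)) (v t), real_inner_comm (P.Q t (x t)) (y t),
    ContinuousLinearMap.adjoint_inner_right, real_inner_comm (u t) (P.H t (y t))]
  ring

theorem IsCostate.integral_inner_controlGradient (hP : ContinuousCoefficients P) (hab : a ≤ b)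
    (hx : IsTrajectory P a b x u) (hlam : IsCostate P a b x u lam)
    (hy : IsTrajectory P a b y v) (hya : y a = 0) :
    ∫ t in a..b, inner ℝ (controlGradient P t (x t) (u t) (lam t)) (v t) =
      (∫ t in a..b, stagePolar P t (x t) (u t) (y t) (v t)) + inner ℝ (lam b) (y b) := by
  have cont_polar := continuousOn_stagePolar hP hx.continuousOn hx.control hy.continuousOn
    hy.control
  have cont_grad := (continuousOn_controlGradient hP hx.continuousOn hx.control
    hlam.continuousOn).inner (𝕜 := ℝ) hy.control
  have hftc := integral_eq_sub_of_hasDerivWithinAt_Icc hab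
    (fun t ht => hlam.hasDerivWithinAt_inner hy ht) (cont_grad.sub cont_polar)
  rw [intervalIntegral.integral_sub (cont_grad.intervalIntegrable_of_Icc hab)
    (cont_polar.intervalIntegrable_of_Icc hab), hya, inner_zero_right, sub_zero] at hftc
  rw [← hftc, add_sub_cancel]

/-- Test the first variation with the response to the control gradient itself. -/
theorem IsSolution.isExtremal (h : Regular P K) (hab : a < b) {p : Vec nx} {L : Vec nx → ℝ}
    (hs : IsSolution P a b p L x u lam) : IsExtremal P a b x u lam := by
  have hP := h.toContinuousCoefficients
  have hx : IsTrajectory P a b x u := hs.admissible.isTrajectory hP hs.continuous_control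
  have hlam : IsCostate P a b x u lam := hs.adjoint_eq
  refine ⟨hx, hlam, ?_⟩
  let e : ℝ → Vec nu := fun t => controlGradient P t (x t) (u t) (lam t)
  have he : ContinuousOn e (Icc a b) :=
    continuousOn_controlGradient hP hx.continuousOn hx.control hlam.continuousOn
  let v : ℝ → Vec nu := fun t => e (projIcc a b hab.le t)
  have hv : Continuous v := he.comp_continuous
    (continuous_subtype_val.comp continuous_projIcc) fun t => (projIcc a b hab.le t).2
  have hy := IsTrajectory.response hP a b 0 hv
  have integral_zero : ∫ t in a..b, ‖e t‖ ^ 2 = 0 := by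
    rw [← hs.first_variation h hab.le hy (response_self a 0 v),
      ← hlam.integral_inner_controlGradient hP hab.le hx hy (response_self a 0 v)]
    refine intervalIntegral.integral_congr fun t ht => ?_
    rw [uIcc_of_le hab.le] at ht
    simp only [v, projIcc_of_mem hab.le ht, e, real_inner_self_eq_norm_sq]
  intro t ht
  by_contra hne
  have integral_pos := intervalIntegral.integral_pos hab (he.norm.pow 2)
    (fun s _ => sq_nonneg ‖e s‖) ⟨t, ht, pow_pos (norm_pos_iff.2 hne) 2⟩
  exact integral_pos.ne' integral_zero

namespace IsExtremal

theorem mono (hx : IsExtremal P a b x u lam) {c d : ℝ} (hac : a ≤ c) (hdb : d ≤ b) :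
    IsExtremal P c d x u lam :=
  have hsub : Icc c d ⊆ Icc a b := Icc_subset_Icc hac hdb
  ⟨hx.trajectory.mono hac hdb, fun t ht => (hx.costate t (hsub ht)).mono hsub,
    fun t ht => hx.stationary t (hsub ht)⟩

theorem sub (hx : IsExtremal P a b x u lam) (hy : IsExtremal P a b y v mu) :
    IsExtremal P a b (fun t => x t - y t) (fun t => u t - v t) (fun t => lam t - mu t) where
  trajectory := by
    simpa only [neg_one_smul, ← sub_eq_add_neg] using hx.trajectory.add_smul hy.trajectory (-1)
  costate t ht := by
    refine ((hx.costate t ht).sub (hy.costate t ht)).congr_deriv ?_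
    simp only [map_sub]
    abel
  stationary t ht := by
    rw [← sub_self 0]
    nth_rewrite 1 [← hx.stationary t ht]
    rw [← hy.stationary t ht]
    simp only [controlGradient, map_sub]
    abel

theorem control_eq (h : Regular P K) (hx : IsExtremal P a b x u lam) {t : ℝ} (ht : t ∈ Icc a b) :
    u t = -(P.R t).inverse (P.H t (x t) + (P.B t).adjoint (lam t)) := by
  have hstat := hx.stationary t ht
  rw [controlGradient, add_assoc, add_eq_zero_iff_eq_neg] at hstat
  rw [← map_neg, ← hstat, (h.isInvertible_R t).inverse_apply_self]

theorem hasDerivWithinAt_inner (hx : IsExtremal P a b x u lam) (hy : IsTrajectory P a b y v)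
    {t : ℝ} (ht : t ∈ Icc a b) :
    HasDerivWithinAt (fun t => inner ℝ (lam t) (y t))
      (-stagePolar P t (x t) (u t) (y t) (v t)) (Icc a b) t := by
  refine (hx.costate.hasDerivWithinAt_inner hy ht).congr_deriv ?_
  rw [hx.stationary t ht, inner_zero_left, zero_sub]

theorem hasDerivWithinAt_inner_self (hx : IsExtremal P a b x u lam) {t : ℝ} (ht : t ∈ Icc a b) :
    HasDerivWithinAt (fun t => inner ℝ (lam t) (x t))
      (-stageCost P t (x t) (u t)) (Icc a b) t := by
  rw [← stagePolar_self]
  exact hx.hasDerivWithinAt_inner hx.trajectory ht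

end IsExtremal

end Pontryagin

end

/-! ### Lower bound of the value function -/

section

theorem sub_le_sub_of_hasDerivWithinAt_le {c d : ℝ} (hcd : c ≤ d) {f g f' g' : ℝ → ℝ}
    (hf : ∀ s ∈ Icc c d, HasDerivWithinAt f (f' s) (Icc c d) s)
    (hg : ∀ s ∈ Icc c d, HasDerivWithinAt g (g' s) (Icc c d) s)
    (hle : ∀ s ∈ Icc c d, f' s ≤ g' s) : f d - f c ≤ g d - g c := by
  have hderiv : ∀ s ∈ Icc c d, HasDerivWithinAt (g - f) (g' s - f' s) (Icc c d) s :=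
    fun s hs => (hg s hs).sub (hf s hs)
  have hmono : MonotoneOn (g - f) (Icc c d) :=
    monotoneOn_of_hasDerivWithinAt_nonneg (convex_Icc c d)
      (fun s hs => (hderiv s hs).continuousWithinAt)
      (fun s hs => (hderiv s (interior_subset hs)).mono interior_subset)
      (fun s hs => sub_nonneg.2 (hle s (interior_subset hs)))
  have hends : g c - f c ≤ g d - f d := hmono (left_mem_Icc.2 hcd) (right_mem_Icc.2 hcd) hcd
  linarith

variable {nx nu : ℕ} {P : Problem nx nu} {K : Constants}

/-- Symmetric terminal weights with quadratic form between `γ_Q` and `λ_Q`. -/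
structure TerminalWeight (K : Constants) (G : Vec nx →L[ℝ] Vec nx) : Prop where
  symm : ∀ x y, inner ℝ (G x) y = inner ℝ x (G y)
  lower : ∀ x, K.gamQ * ‖x‖ ^ 2 ≤ inner ℝ x (G x)
  upper : ∀ x, inner ℝ x (G x) ≤ K.lamQ * ‖x‖ ^ 2

namespace IsExtremal

variable {a b : ℝ} {x lam : ℝ → Vec nx} {u : ℝ → Vec nu} {G : Vec nx →L[ℝ] Vec nx}

theorem inner_antitone (h : Regular P K) (hx : IsExtremal P a b x u lam) {t e : ℝ} (hat : a ≤ t)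
    (hte : t ≤ e) (heb : e ≤ b) : inner ℝ (lam e) (x e) ≤ inner ℝ (lam t) (x t) := by
  have hsub := sub_le_sub_of_hasDerivWithinAt_le hte
    (fun s hs => (hx.mono hat heb).hasDerivWithinAt_inner_self hs)
    (fun s _ => hasDerivWithinAt_const s (Icc t e) (0 : ℝ))
    (fun s _ => neg_nonpos.2 (h.stageCost_nonneg s (x s) (u s)))
  linarith

theorem le_inner_terminal (h : Regular P K) (hx : IsExtremal P a b x u lam)
    (hG : TerminalWeight K G) (hb : lam b = G (x b)) {t : ℝ} (ht : t ∈ Icc a b) :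
    K.gamQ * ‖x b‖ ^ 2 ≤ inner ℝ (lam t) (x t) := by
  refine le_trans ?_ (hx.inner_antitone h ht.1 ht.2 le_rfl)
  rw [hb, real_inner_comm]
  exact hG.lower _

theorem inner_nonneg (h : Regular P K) (hx : IsExtremal P a b x u lam)
    (hG : TerminalWeight K G) (hb : lam b = G (x b)) {t : ℝ} (ht : t ∈ Icc a b) :
    0 ≤ inner ℝ (lam t) (x t) :=
  (mul_nonneg h.gamQ_pos.le (sq_nonneg _)).trans (hx.le_inner_terminal h hG hb ht)

end IsExtremal

section DualEstimate

namespace Regular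

theorem norm_drift_le (h : Regular P K) (t : ℝ) (x : Vec nx) :
    ‖P.A t x - P.B t ((P.R t).inverse (P.H t x))‖ ≤ K.growth * ‖x‖ :=
  calc ‖P.A t x - P.B t ((P.R t).inverse (P.H t x))‖
      ≤ ‖P.A t x‖ + ‖P.B t ((P.R t).inverse (P.H t x))‖ := norm_sub_le _ _
    _ ≤ K.lamA * ‖x‖ + K.lamB * (K.lamH / K.gamR * ‖x‖) :=
        add_le_add ((P.A t).le_of_opNorm_le (h.normA t) x)
          (((P.B t).le_of_opNorm_le (h.normB t) _).trans
            (mul_le_mul_of_nonneg_left (h.norm_R_inverse_H_le t x) h.lamB_pos.le))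
    _ = K.growth * ‖x‖ := by unfold Constants.growth; ring

/-- Young's inequality in the state and in the shifted control, maximizing the left-hand side over
both. -/
theorem neg_two_mul_inner_sub_stageCost_le (h : Regular P K) (t : ℝ) (x mu mu' : Vec nx)
    (u : Vec nu) :
    -(2 * (inner ℝ mu' x + inner ℝ mu (P.A t x + P.B t u))) - stageCost P t x u ≤
      (‖mu'‖ + K.growth * ‖mu‖) ^ 2 / K.gamQ + (K.lamB * ‖mu‖) ^ 2 / K.gamR := by
  set v := shifted P t x u with hv
  have hsplit : P.A t x + P.B t u =
      (P.A t x - P.B t ((P.R t).inverse (P.H t x))) + P.B t v := by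
    rw [hv, shifted, map_add]
    abel
  have hstate : -(‖mu'‖ * ‖x‖) ≤ inner ℝ mu' x :=
    neg_le_of_abs_le (abs_real_inner_le_norm mu' x)
  have hdrift : -(‖mu‖ * (K.growth * ‖x‖)) ≤
      inner ℝ mu (P.A t x - P.B t ((P.R t).inverse (P.H t x))) :=
    neg_le_of_abs_le ((abs_real_inner_le_norm mu _).trans
      (mul_le_mul_of_nonneg_left (h.norm_drift_le t x) (norm_nonneg mu)))
  have hcontrol : -(‖mu‖ * (K.lamB * ‖v‖)) ≤ inner ℝ mu (P.B t v) :=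
    neg_le_of_abs_le ((abs_real_inner_le_norm mu _).trans
      (mul_le_mul_of_nonneg_left ((P.B t).le_of_opNorm_le (h.normB t) v) (norm_nonneg mu)))
  have young : ∀ {c : ℝ}, 0 < c → ∀ m z : ℝ, 2 * (m * z) - c * z ^ 2 ≤ m ^ 2 / c := by
    intro c hc m z
    rw [le_div_iff₀ hc]
    nlinarith [sq_nonneg (m - c * z)]
  have young_state := young h.gamQ_pos (‖mu'‖ + K.growth * ‖mu‖) ‖x‖
  have young_control := young h.gamR_pos (K.lamB * ‖mu‖) ‖v‖
  have hcost : K.gamQ * ‖x‖ ^ 2 + K.gamR * ‖v‖ ^ 2 ≤ stageCost P t x u := h.le_stageCost t x u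
  rw [hsplit, inner_add_right]
  linarith

end Regular

namespace IsExtremal

variable {a b : ℝ} {x lam : ℝ → Vec nx} {u : ℝ → Vec nu} {G : Vec nx →L[ℝ] Vec nx}

theorem dual_estimate (h : Regular P K) (hx : IsExtremal P a b x u lam) {t e θ : ℝ}
    (hat : a ≤ t) (hte : t ≤ e) (heb : e ≤ b) (hθ : 0 ≤ θ) (hθe : θ * (e - t) ≤ 1)
    (q : Vec nx) :
    inner ℝ (lam e) (x e) - 2 * ((1 - θ * (e - t)) * inner ℝ q (x e)) + 2 * inner ℝ q (x t) -
      ((θ + K.growth) ^ 2 / K.gamQ + K.lamB ^ 2 / K.gamR) * ‖q‖ ^ 2 * (e - t) ≤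
      inner ℝ (lam t) (x t) := by
  have hx' := hx.mono hat heb
  have := h.growth_pos
  have := h.lamB_pos
  have := h.gamQ_pos
  have := h.gamR_pos
  let mu : ℝ → Vec nx := fun s => (1 - θ * (s - t)) • q
  have hmu : ∀ s, HasDerivWithinAt mu (-θ • q) (Icc t e) s := fun s => by
    simpa using (((((hasDerivAt_id s).sub_const t).const_mul θ).const_sub 1).smul_const
      q).hasDerivWithinAt
  have norm_mu_le : ∀ s ∈ Icc t e, ‖mu s‖ ≤ ‖q‖ := by
    intro s hs
    have hst : 0 ≤ θ * (s - t) := mul_nonneg hθ (sub_nonneg.2 hs.1)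
    have hse : θ * (s - t) ≤ 1 := hθe.trans' (by gcongr; exact hs.2)
    rw [norm_smul, Real.norm_of_nonneg (sub_nonneg.2 hse)]
    exact mul_le_of_le_one_left (norm_nonneg q) (by linarith)
  have norm_mu' : ‖-θ • q‖ = θ * ‖q‖ := by
    rw [neg_smul, norm_neg, norm_smul, Real.norm_of_nonneg hθ]
  have hrate : ∀ s ∈ Icc t e, -stageCost P s (x s) (u s) -
      2 * (inner ℝ (mu s) (P.A s (x s) + P.B s (u s)) + inner ℝ (-θ • q) (x s)) ≤
      ((θ + K.growth) ^ 2 / K.gamQ + K.lamB ^ 2 / K.gamR) * ‖q‖ ^ 2 * 1 := by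
    intro s hs
    have hpoint := h.neg_two_mul_inner_sub_stageCost_le s (x s) (mu s) (-θ • q) (u s)
    have hmax : (‖-θ • q‖ + K.growth * ‖mu s‖) ^ 2 / K.gamQ + (K.lamB * ‖mu s‖) ^ 2 / K.gamR ≤
        (θ * ‖q‖ + K.growth * ‖q‖) ^ 2 / K.gamQ + (K.lamB * ‖q‖) ^ 2 / K.gamR := by
      rw [norm_mu']
      gcongr <;> exact norm_mu_le s hs
    linear_combination hpoint + hmax
  have hint := sub_le_sub_of_hasDerivWithinAt_le hte
    (fun s hs => (hx'.hasDerivWithinAt_inner_self hs).sub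
      (((hmu s).inner ℝ (hx'.trajectory.state s hs)).const_mul 2))
    (fun s _ => (hasDerivWithinAt_id s (Icc t e)).const_mul _) hrate
  simp only [Pi.sub_apply, id, mu, real_inner_smul_left, sub_self, mul_zero, sub_zero,
    one_mul] at hint
  linarith

theorem interior_dual_estimate (h : Regular P K) (hx : IsExtremal P a b x u lam)
    (hG : TerminalWeight K G) (hb : lam b = G (x b)) {t : ℝ} (ht : t ∈ Icc a b)
    (htb : t + K.σ ≤ b) (q : Vec nx) :
    2 * inner ℝ q (x t) -
      ((1 / K.σ + K.growth) ^ 2 / K.gamQ + K.lamB ^ 2 / K.gamR) * K.σ * ‖q‖ ^ 2 ≤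
      inner ℝ (lam t) (x t) := by
  have hσ := h.σ_pos
  have hnonneg : 0 ≤ inner ℝ (lam (t + K.σ)) (x (t + K.σ)) :=
    hx.inner_nonneg h hG hb ⟨by linarith [ht.1], htb⟩
  have hunit : 1 / K.σ * (t + K.σ - t) = 1 := by
    rw [add_sub_cancel_left, one_div_mul_cancel hσ.ne']
  have hdual := hx.dual_estimate h ht.1 (by linarith) htb (by positivity) hunit.le q
  rw [hunit, add_sub_cancel_left, sub_self, zero_mul] at hdual
  linarith

theorem terminal_dual_estimate (h : Regular P K) (hx : IsExtremal P a b x u lam)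
    (hG : TerminalWeight K G) (hb : lam b = G (x b)) {t : ℝ} (ht : t ∈ Icc a b)
    (htb : b ≤ t + K.σ) (q : Vec nx) :
    2 * inner ℝ q (x t) -
      ((K.growth ^ 2 / K.gamQ + K.lamB ^ 2 / K.gamR) * K.σ + 1 / K.gamQ) * ‖q‖ ^ 2 ≤
      inner ℝ (lam t) (x t) := by
  have hq := h.gamQ_pos
  have := h.gamR_pos
  have hweight : K.gamQ * ‖x b‖ ^ 2 ≤ inner ℝ (lam b) (x b) :=
    hx.le_inner_terminal h hG hb ⟨ht.1.trans ht.2, le_rfl⟩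
  have hinner := real_inner_le_norm q (x b)
  have hsquare : 0 ≤ 1 / K.gamQ * ‖q‖ ^ 2 - 2 * (‖q‖ * ‖x b‖) + K.gamQ * ‖x b‖ ^ 2 := by
    have : 0 ≤ 1 / K.gamQ * (‖q‖ - K.gamQ * ‖x b‖) ^ 2 := by positivity
    refine this.trans_eq ?_
    field_simp
    ring
  have hlength : (K.growth ^ 2 / K.gamQ + K.lamB ^ 2 / K.gamR) * ‖q‖ ^ 2 * (b - t) ≤
      (K.growth ^ 2 / K.gamQ + K.lamB ^ 2 / K.gamR) * ‖q‖ ^ 2 * K.σ := by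
    gcongr
    linarith
  have hdual := hx.dual_estimate h ht.1 ht.2 le_rfl le_rfl (by simp) q
  rw [zero_mul, sub_zero, one_mul, zero_add] at hdual
  linarith

end IsExtremal

end DualEstimate

section LowerConstant

theorem one_add_sq_le_exp {z : ℝ} (hz : 0 ≤ z) : (1 + z) ^ 2 ≤ Real.exp (2 * z) := by
  rw [two_mul, Real.exp_add, ← sq]
  gcongr
  linarith [Real.add_one_le_exp z]

theorem sq_one_sub_exp_neg_le {z : ℝ} (hz : 0 ≤ z) : (1 - Real.exp (-z)) ^ 2 ≤ z := by
  have hle : 1 - Real.exp (-z) ≤ z := by linarith [Real.add_one_le_exp (-z)]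
  have hexp : Real.exp (-z) ≤ 1 := Real.exp_le_one_iff.2 (by linarith)
  nlinarith [Real.exp_pos (-z)]

namespace Constants.Positive

theorem dualα₀_pos (hK : K.Positive) : 0 < K.dualα₀ := by
  have hg := hK.growth_pos
  have hexp : Real.exp (-2 * K.growth * K.σ) < 1 :=
    Real.exp_lt_one_iff.2 (by nlinarith [mul_pos hg hK.σ_pos])
  exact div_pos (by linarith) (by positivity)

theorem dualα₁_nonneg (hK : K.Positive) : 0 ≤ K.dualα₁ := by
  have hg := hK.growth_pos
  have := hK.σ_pos
  have hexp : 1 ≤ Real.exp (2 * K.growth * K.σ) := Real.one_le_exp (by positivity)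
  exact div_nonneg (by linarith) (by positivity)

theorem c₀_pos (hK : K.Positive) : 0 < K.c₀ := by
  have := hK.growth_pos
  have := hK.lamB_pos
  have := hK.gamR_pos
  have := hK.gamQ_pos
  have := hK.dualα₀_pos
  have := hK.dualα₁_nonneg
  refine mul_pos (lt_min ?_ ?_) (Real.exp_pos _) <;> positivity

theorem c₀_mul_exp_le_left (hK : K.Positive) :
    K.c₀ * ((K.lamB ^ 2 / K.gamR + 1 / (K.gamQ * K.dualα₀ ^ 2)) *
      Real.exp (2 * (K.growth * K.σ)) / (2 * K.growth)) ≤ 1 := by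
  have := hK.growth_pos
  have := hK.lamB_pos
  have := hK.gamR_pos
  have := hK.gamQ_pos
  have := hK.dualα₀_pos
  have := hK.dualα₁_nonneg
  set D := K.lamB ^ 2 / K.gamR * (1 + K.dualα₁ / K.dualα₀) ^ 2 + 1 / (K.gamQ * K.dualα₀ ^ 2)
    with hD
  have hDpos : 0 < D := by positivity
  have hle : K.lamB ^ 2 / K.gamR + 1 / (K.gamQ * K.dualα₀ ^ 2) ≤ D := by
    rw [hD]
    gcongr
    exact le_mul_of_one_le_right (by positivity)
      (one_le_pow₀ (le_add_of_nonneg_right (by positivity)))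
  have hc₀ : K.c₀ ≤ 2 * K.growth * D⁻¹ * Real.exp (-2 * K.growth * K.σ) :=
    mul_le_mul_of_nonneg_right (min_le_left _ _) (Real.exp_pos _).le
  calc _ ≤ 2 * K.growth * D⁻¹ * Real.exp (-2 * K.growth * K.σ) *
        (D * Real.exp (2 * (K.growth * K.σ)) / (2 * K.growth)) := by gcongr
    _ = Real.exp (-2 * K.growth * K.σ) * Real.exp (2 * (K.growth * K.σ)) := by field_simp
    _ = 1 := by rw [← Real.exp_add]; ring_nf; exact Real.exp_zero

theorem c₀_mul_exp_le_right (hK : K.Positive) :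
    K.c₀ * ((K.lamB ^ 2 / (2 * K.gamR * K.growth) + 1 / K.gamQ) *
      Real.exp (2 * (K.growth * K.σ))) ≤ 1 := by
  have := hK.growth_pos
  have := hK.gamR_pos
  have := hK.gamQ_pos
  set D := K.lamB ^ 2 / (2 * K.gamR * K.growth) + 1 / K.gamQ
  have hDpos : 0 < D := by positivity
  have hc₀ : K.c₀ ≤ D⁻¹ * Real.exp (-2 * K.growth * K.σ) :=
    mul_le_mul_of_nonneg_right (min_le_right _ _) (Real.exp_pos _).le
  calc _ ≤ D⁻¹ * Real.exp (-2 * K.growth * K.σ) *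
        (D * Real.exp (2 * (K.growth * K.σ))) := by gcongr
    _ = Real.exp (-2 * K.growth * K.σ) * Real.exp (2 * (K.growth * K.σ)) := by field_simp
    _ = 1 := by rw [← Real.exp_add]; ring_nf; exact Real.exp_zero

theorem σ_le_exp_div (hK : K.Positive) :
    K.σ ≤ Real.exp (2 * (K.growth * K.σ)) / (2 * K.growth) := by
  have := hK.growth_pos
  rw [le_div_iff₀ (by positivity)]
  linarith [Real.add_one_le_exp (2 * (K.growth * K.σ))]

theorem two_mul_growth_mul_dualα₀ (hK : K.Positive) :
    2 * K.growth * K.dualα₀ = 1 - Real.exp (-(2 * (K.growth * K.σ))) := by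
  have := hK.growth_pos
  unfold Constants.dualα₀
  field_simp

theorem dualα₀_sq_mul_le_σ (hK : K.Positive) : K.dualα₀ ^ 2 * (2 * K.growth) ≤ K.σ := by
  have := hK.growth_pos
  have := hK.σ_pos
  have hsq : (2 * K.growth * K.dualα₀) ^ 2 ≤ 2 * (K.growth * K.σ) := by
    rw [hK.two_mul_growth_mul_dualα₀]
    exact sq_one_sub_exp_neg_le (by positivity)
  refine le_of_mul_le_mul_left ?_ (show 0 < 2 * K.growth by positivity)
  linarith

theorem dualα₀_sq_mul_le_one (hK : K.Positive) : K.dualα₀ ^ 2 * (2 * K.growth) ^ 2 ≤ 1 := by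
  have := hK.growth_pos
  have := hK.dualα₀_pos
  rw [← mul_pow, mul_comm, sq_le_one_iff₀ (by positivity), hK.two_mul_growth_mul_dualα₀]
  linarith [Real.exp_pos (-(2 * (K.growth * K.σ)))]

theorem c₀_mul_interior_le_one (hK : K.Positive) :
    K.c₀ * (((1 / K.σ + K.growth) ^ 2 / K.gamQ + K.lamB ^ 2 / K.gamR) * K.σ) ≤ 1 := by
  have hg := hK.growth_pos
  have hσ := hK.σ_pos
  have := hK.gamR_pos
  have := hK.gamQ_pos
  have := hK.dualα₀_pos
  refine (mul_le_mul_of_nonneg_left ?_ hK.c₀_pos.le).trans hK.c₀_mul_exp_le_left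
  set E := Real.exp (2 * (K.growth * K.σ))
  have hstate : (1 / K.σ + K.growth) ^ 2 * K.σ ≤ E / (K.dualα₀ ^ 2 * (2 * K.growth)) :=
    calc (1 / K.σ + K.growth) ^ 2 * K.σ = (1 + K.growth * K.σ) ^ 2 / K.σ := by field_simp
      _ ≤ E / (K.dualα₀ ^ 2 * (2 * K.growth)) := by
        gcongr
        · exact one_add_sq_le_exp (by positivity)
        · exact hK.dualα₀_sq_mul_le_σ
  calc _ = (1 / K.σ + K.growth) ^ 2 * K.σ / K.gamQ + K.lamB ^ 2 / K.gamR * K.σ := by ring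
    _ ≤ E / (K.dualα₀ ^ 2 * (2 * K.growth)) / K.gamQ +
        K.lamB ^ 2 / K.gamR * (E / (2 * K.growth)) := by gcongr; exact hK.σ_le_exp_div
    _ = _ := by field_simp; ring

/-- Which of the two terms of `c₀` applies depends on whether `2a ≥ 1`. -/
theorem c₀_mul_terminal_le_one (hK : K.Positive) :
    K.c₀ * ((K.growth ^ 2 / K.gamQ + K.lamB ^ 2 / K.gamR) * K.σ + 1 / K.gamQ) ≤ 1 := by
  have hg := hK.growth_pos
  have hz := mul_pos hg hK.σ_pos
  have := hK.gamR_pos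
  have := hK.gamQ_pos
  have hα := hK.dualα₀_pos
  set E := Real.exp (2 * (K.growth * K.σ)) with hE
  have hE1 : 2 * (K.growth * K.σ) + 1 ≤ E := Real.add_one_le_exp _
  have hsplit : (K.growth ^ 2 / K.gamQ + K.lamB ^ 2 / K.gamR) * K.σ + 1 / K.gamQ =
      (K.growth ^ 2 * K.σ + 1) / K.gamQ + K.lamB ^ 2 / K.gamR * K.σ := by ring
  rw [hsplit]
  rcases le_total (1 / 2) K.growth with hlarge | hsmall
  · refine (mul_le_mul_of_nonneg_left ?_ hK.c₀_pos.le).trans hK.c₀_mul_exp_le_left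
    have hstate : K.growth ^ 2 * K.σ + 1 ≤ E / (K.dualα₀ ^ 2 * (2 * K.growth)) :=
      calc K.growth ^ 2 * K.σ + 1 ≤ 2 * K.growth * E := by nlinarith
        _ ≤ E / (K.dualα₀ ^ 2 * (2 * K.growth)) := by
          rw [le_div_iff₀ (by positivity)]
          nlinarith [hK.dualα₀_sq_mul_le_one]
    calc _ ≤ E / (K.dualα₀ ^ 2 * (2 * K.growth)) / K.gamQ +
        K.lamB ^ 2 / K.gamR * (E / (2 * K.growth)) := by gcongr; exact hK.σ_le_exp_div
      _ = _ := by rw [← hE]; field_simp; ring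
  · refine (mul_le_mul_of_nonneg_left ?_ hK.c₀_pos.le).trans hK.c₀_mul_exp_le_right
    have hstate : K.growth ^ 2 * K.σ + 1 ≤ E := by nlinarith
    calc _ ≤ E / K.gamQ + K.lamB ^ 2 / K.gamR * (E / (2 * K.growth)) := by
          gcongr; exact hK.σ_le_exp_div
      _ = _ := by rw [← hE]; field_simp; ring

end Constants.Positive

end LowerConstant

theorem mul_sq_norm_le_of_dual {E : Type*} [NormedAddCommGroup E] [InnerProductSpace ℝ E]
    {c D V : ℝ} (hc : 0 ≤ c) (hcD : c * D ≤ 1) {x : E}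
    (hV : ∀ q, 2 * inner ℝ q x - D * ‖q‖ ^ 2 ≤ V) : c * ‖x‖ ^ 2 ≤ V := by
  have hq := hV (c • x)
  rw [real_inner_smul_left, real_inner_self_eq_norm_sq, norm_smul, Real.norm_of_nonneg hc] at hq
  have hle := mul_le_mul_of_nonneg_right hcD (mul_nonneg hc (sq_nonneg ‖x‖))
  linarith

theorem IsExtremal.c₀_mul_le_inner (h : Regular P K) {a b : ℝ} {x lam : ℝ → Vec nx}
    {u : ℝ → Vec nu} {G : Vec nx →L[ℝ] Vec nx} (hx : IsExtremal P a b x u lam)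
    (hG : TerminalWeight K G) (hb : lam b = G (x b)) {t : ℝ} (ht : t ∈ Icc a b) :
    K.c₀ * ‖x t‖ ^ 2 ≤ inner ℝ (lam t) (x t) := by
  have hK := h.toPositive
  rcases le_total (t + K.σ) b with hinterior | hterminal
  · exact mul_sq_norm_le_of_dual hK.c₀_pos.le hK.c₀_mul_interior_le_one
      (hx.interior_dual_estimate h hG hb ht hinterior)
  · exact mul_sq_norm_le_of_dual hK.c₀_pos.le hK.c₀_mul_terminal_le_one
      (hx.terminal_dual_estimate h hG hb ht hterminal)

end

/-! ### Upper bound of the value function -/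

section

variable {nx nu : ℕ} {P : Problem nx nu} {K : Constants}

section Competitor

variable {a b t e : ℝ} {x y lam : ℝ → Vec nx} {u v : ℝ → Vec nu}

theorem IsExtremal.inner_le_of_trajectory (h : Regular P K) (hx : IsExtremal P a b x u lam)
    (hat : a ≤ t) (hte : t ≤ e) (heb : e ≤ b) (hy : IsTrajectory P t e y v) (hyt : y t = x t) :
    inner ℝ (lam t) (x t) ≤ 2 * inner ℝ (lam e) (y e) - inner ℝ (lam e) (x e) +
      ∫ s in t..e, stageCost P s (y s) (v s) := by
  have hx' := hx.mono hat heb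
  have hcost := continuousOn_stageCost h.toContinuousCoefficients hy.continuousOn hy.control
  have hsub := sub_le_sub_of_hasDerivWithinAt_le hte
    (fun s hs => ((hx'.hasDerivWithinAt_inner hy hs).const_mul 2).sub
      (hx'.hasDerivWithinAt_inner_self hs) |>.neg)
    (fun s hs => hasDerivWithinAt_integral_Icc hcost hs)
    (fun s _ => by linarith [h.two_mul_stagePolar_le s (x s) (y s) (u s) (v s)])
  simp only [Pi.neg_apply, Pi.sub_apply, hyt, intervalIntegral.integral_same] at hsub
  linarith

theorem integral_stageCost_le (h : Regular P K) (hte : t ≤ e) (hy : IsTrajectory P t e y v) :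
    ∫ s in t..e, stageCost P s (y s) (v s) ≤ K.lamQ * (∫ s in t..e, ‖y s‖ ^ 2) +
      K.lamR * (2 * (∫ s in t..e, ‖v s‖ ^ 2) +
        2 * (K.lamH / K.gamR) ^ 2 * ∫ s in t..e, ‖y s‖ ^ 2) := by
  have hcost := continuousOn_stageCost h.toContinuousCoefficients hy.continuousOn hy.control
  have int_y : IntervalIntegrable (fun s => ‖y s‖ ^ 2) volume t e :=
    (hy.continuousOn.norm.pow 2).intervalIntegrable_of_Icc hte
  have int_v : IntervalIntegrable (fun s => ‖v s‖ ^ 2) volume t e :=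
    (hy.control.norm.pow 2).intervalIntegrable_of_Icc hte
  simp only [← intervalIntegral.integral_const_mul]
  rw [← intervalIntegral.integral_add (int_v.const_mul _) (int_y.const_mul _),
    ← intervalIntegral.integral_const_mul,
    ← intervalIntegral.integral_add (int_y.const_mul _)
      (((int_v.const_mul _).add (int_y.const_mul _)).const_mul _)]
  refine intervalIntegral.integral_mono_on hte (hcost.intervalIntegrable_of_Icc hte)
    ((int_y.const_mul _).add (((int_v.const_mul _).add (int_y.const_mul _)).const_mul _))
    fun s _ => (h.stageCost_le s (y s) (v s)).trans ?_
  have := h.lamR_pos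
  gcongr
  exact h.norm_shifted_sq_le s (y s) (v s)

end Competitor

theorem integral_exp_mul_sub {c : ℝ} (hc : c ≠ 0) (t e : ℝ) :
    ∫ s in t..e, Real.exp (c * (s - t)) = (Real.exp (c * (e - t)) - 1) / c := by
  rw [intervalIntegral.integral_comp_sub_right fun s => Real.exp (c * s),
    intervalIntegral.integral_comp_mul_left Real.exp hc, integral_exp, sub_self, mul_zero,
    Real.exp_zero, smul_eq_mul, inv_mul_eq_div]

theorem integral_sq_norm_le_of_norm_le_exp {E : Type*} [NormedAddCommGroup E]
    {c t e σ M : ℝ} (hc : 0 < c) (hte : t ≤ e) (hσ : e ≤ t + σ) {f : ℝ → E}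
    (hf : ContinuousOn f (Icc t e))
    (hle : ∀ s ∈ Icc t e, ‖f s‖ ≤ M * Real.exp (c * (s - t))) :
    ∫ s in t..e, ‖f s‖ ^ 2 ≤ M ^ 2 * ((Real.exp (2 * c * σ) - 1) / (2 * c)) :=
  calc ∫ s in t..e, ‖f s‖ ^ 2 ≤ ∫ s in t..e, M ^ 2 * Real.exp (2 * c * (s - t)) := by
        refine intervalIntegral.integral_mono_on hte
          ((hf.norm.pow 2).intervalIntegrable_of_Icc hte)
          (Continuous.intervalIntegrable (by fun_prop) t e) fun s hs => ?_
        refine (pow_le_pow_left₀ (norm_nonneg _) (hle s hs) 2).trans_eq ?_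
        rw [mul_pow, ← Real.exp_nat_mul]
        ring_nf
    _ = M ^ 2 * ((Real.exp (2 * c * (e - t)) - 1) / (2 * c)) := by
        rw [intervalIntegral.integral_const_mul, integral_exp_mul_sub (by positivity)]
    _ ≤ M ^ 2 * ((Real.exp (2 * c * σ) - 1) / (2 * c)) := by
        gcongr
        linarith

theorem norm_evolution_apply_le (h : Regular P K) {t s c : ℝ} (hts : t ≤ s) (hc : K.lamA ≤ c)
    (z : Vec nx) : ‖evolution P.A s t z‖ ≤ Real.exp (c * (s - t)) * ‖z‖ := by
  refine (evolution P.A s t).le_of_opNorm_le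
    ((norm_evolution_le h.contA h.normA s t).trans ?_) z
  rw [abs_of_nonneg (sub_nonneg.2 hts)]
  gcongr

section UpperConstant

namespace Constants

theorem α₁'_eq (K : Constants) : K.α₁' = K.lamB ^ 2 * K.dualα₁ := by
  rw [α₁', dualα₁, mul_right_comm 2 K.σ K.growth, mul_div_assoc]

namespace Positive

theorem lamQ_le_lamQ_add (hK : K.Positive) : K.lamQ ≤ K.lamQ + K.lamH ^ 2 / K.gamR :=
  le_add_of_nonneg_right (div_nonneg (sq_nonneg _) hK.gamR_pos.le)

theorem α₁'_nonneg (hK : K.Positive) : 0 ≤ K.α₁' :=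
  K.α₁'_eq ▸ mul_nonneg (sq_nonneg _) hK.dualα₁_nonneg

theorem two_div_α₀_le (hK : K.Positive) : 2 / K.α₀ ≤ K.α₀'⁻¹ := by
  have := hK.lamA_pos
  have := hK.σ_pos
  have hexp : 1 ≤ Real.exp (2 * K.lamA * K.σ) := Real.one_le_exp (by positivity)
  rw [Constants.α₀', inv_inv]
  exact le_add_of_nonneg_right (mul_nonneg (by positivity) (sub_nonneg.2 hexp))

theorem α₀'_pos (hK : K.Positive) : 0 < K.α₀' :=
  inv_pos.1 ((div_pos two_pos hK.α₀_pos).trans_le hK.two_div_α₀_le)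

theorem α₀'_le (hK : K.Positive) : K.α₀' ≤ K.α₀ := by
  have := hK.α₀_pos
  refine (inv_le_inv₀ this hK.α₀'_pos).1 (le_trans ?_ hK.two_div_α₀_le)
  rw [← one_div]
  gcongr
  norm_num

theorem c₁_pos (hK : K.Positive) : 0 < K.c₁ := by
  have := hK.growth_pos
  have := hK.lamQ_pos
  have := hK.gamR_pos
  exact mul_pos (lt_max_of_lt_right (by positivity)) (Real.exp_pos _)

theorem dualα₁_le (hK : K.Positive) :
    K.dualα₁ ≤ 1 / (2 * K.growth) * Real.exp (2 * K.growth * K.σ) := by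
  have := hK.growth_pos
  rw [dualα₁, one_div_mul_eq_div]
  gcongr
  linarith

theorem terminal_le_c₁ (hK : K.Positive) :
    K.lamQ * (Real.exp (2 * K.growth * K.σ) + K.dualα₁) ≤ K.c₁ := by
  have := hK.growth_pos
  have := hK.lamQ_pos
  calc K.lamQ * (Real.exp (2 * K.growth * K.σ) + K.dualα₁)
      ≤ K.lamQ * (Real.exp (2 * K.growth * K.σ) +
          1 / (2 * K.growth) * Real.exp (2 * K.growth * K.σ)) := by
        gcongr
        exact hK.dualα₁_le
    _ = K.lamQ * (1 + 1 / (2 * K.growth)) * Real.exp (2 * K.growth * K.σ) := by ring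
    _ ≤ (K.lamQ + K.lamH ^ 2 / K.gamR) * (1 + 1 / (2 * K.growth)) *
          Real.exp (2 * K.growth * K.σ) := by
        gcongr
        exact hK.lamQ_le_lamQ_add
    _ ≤ K.c₁ := mul_le_mul_of_nonneg_right (le_max_right _ _) (Real.exp_pos _).le

theorem interior_le_c₁ (hK : K.Positive) (hα : K.α₀ ≤ K.α₁') :
    K.lamQ * ((1 + K.α₁' / K.α₀') ^ 2 * K.dualα₁) + K.lamR * K.α₀'⁻¹ ≤ K.c₁ := by
  have := hK.growth_pos
  have := hK.lamQ_pos
  have := hK.lamR_pos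
  have := hK.gamR_pos
  have hα₀' := hK.α₀'_pos
  have hdual := hK.dualα₁_nonneg
  have hinv : K.α₀'⁻¹ ≤ K.lamB ^ 2 * K.dualα₁ / K.α₀' ^ 2 :=
    calc K.α₀'⁻¹ = K.α₀' / K.α₀' ^ 2 := by field_simp
      _ ≤ K.lamB ^ 2 * K.dualα₁ / K.α₀' ^ 2 := by
        gcongr
        exact (hK.α₀'_le.trans hα).trans_eq K.α₁'_eq
  calc K.lamQ * ((1 + K.α₁' / K.α₀') ^ 2 * K.dualα₁) + K.lamR * K.α₀'⁻¹
      ≤ (K.lamQ + K.lamH ^ 2 / K.gamR) * ((1 + K.α₁' / K.α₀') ^ 2 * K.dualα₁) +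
          K.lamR * (K.lamB ^ 2 * K.dualα₁ / K.α₀' ^ 2) := by
        gcongr
        exact hK.lamQ_le_lamQ_add
    _ = ((K.lamQ + K.lamH ^ 2 / K.gamR) * (1 + K.α₁' / K.α₀') ^ 2 +
          K.lamR * K.lamB ^ 2 / K.α₀' ^ 2) * K.dualα₁ := by ring
    _ ≤ ((K.lamQ + K.lamH ^ 2 / K.gamR) * (1 + K.α₁' / K.α₀') ^ 2 +
          K.lamR * K.lamB ^ 2 / K.α₀' ^ 2) *
          (1 / (2 * K.growth) * Real.exp (2 * K.growth * K.σ)) := by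
        gcongr
        exact hK.dualα₁_le
    _ ≤ K.c₁ := by
        rw [← mul_assoc]
        exact mul_le_mul_of_nonneg_right (le_max_left _ _) (Real.exp_pos _).le

end Positive

end Constants

end UpperConstant

theorem TerminalWeight.two_mul_inner_sub_le {G : Vec nx →L[ℝ] Vec nx} (hK : K.Positive)
    (hG : TerminalWeight K G) (x y : Vec nx) :
    2 * inner ℝ (G x) y - inner ℝ (G x) x ≤ K.lamQ * ‖y‖ ^ 2 := by
  have hsq : 0 ≤ inner ℝ (y - x) (G (y - x)) :=
    (mul_nonneg hK.gamQ_pos.le (sq_nonneg _)).trans (hG.lower (y - x))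
  simp only [map_sub, inner_sub_left, inner_sub_right, ← hG.symm x y,
    real_inner_comm (G x) y] at hsq
  rw [hG.symm x x]
  linarith [hG.upper y]

theorem IsExtremal.inner_le_near_end (h : Regular P K) {a b : ℝ}
    {x lam : ℝ → Vec nx} {u : ℝ → Vec nu} {G : Vec nx →L[ℝ] Vec nx}
    (hx : IsExtremal P a b x u lam) (hG : TerminalWeight K G) (hb : lam b = G (x b)) {t : ℝ}
    (ht : t ∈ Icc a b) (hσ : b ≤ t + K.σ) : inner ℝ (lam t) (x t) ≤ K.c₁ * ‖x t‖ ^ 2 := by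
  have hg := h.growth_pos
  have hQ := h.lamQ_pos
  set y := response P t (x t) (fun _ => (0 : Vec nu)) with hy_def
  have hy : IsTrajectory P t b y fun _ => 0 :=
    .response h.toContinuousCoefficients t b (x t) continuous_const
  have hyt : y t = x t := response_self t (x t) _
  have norm_y_le : ∀ s ∈ Icc t b, ‖y s‖ ≤ ‖x t‖ * Real.exp (K.growth * (s - t)) := by
    intro s hs
    rw [mul_comm]
    simpa [hy_def, Schwarz.response] using
      norm_evolution_apply_le h hs.1 h.lamA_le_growth (x t)
  have hend : ‖y b‖ ^ 2 ≤ ‖x t‖ ^ 2 * Real.exp (2 * K.growth * K.σ) :=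
    calc ‖y b‖ ^ 2 ≤ (‖x t‖ * Real.exp (K.growth * K.σ)) ^ 2 := by
          gcongr
          refine (norm_y_le b (right_mem_Icc.2 ht.2)).trans ?_
          gcongr
          linarith
      _ = ‖x t‖ ^ 2 * Real.exp (2 * K.growth * K.σ) := by
          rw [mul_pow, ← Real.exp_nat_mul]
          ring_nf
  have hintegral : ∫ s in t..b, ‖y s‖ ^ 2 ≤ ‖x t‖ ^ 2 * K.dualα₁ :=
    integral_sq_norm_le_of_norm_le_exp hg ht.2 hσ hy.continuousOn norm_y_le
  have hcost : ∫ s in t..b, stageCost P s (y s) 0 ≤ K.lamQ * ∫ s in t..b, ‖y s‖ ^ 2 := by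
    rw [← intervalIntegral.integral_const_mul]
    refine intervalIntegral.integral_mono_on ht.2
      ((continuousOn_stageCost h.toContinuousCoefficients hy.continuousOn
        hy.control).intervalIntegrable_of_Icc ht.2)
      (((hy.continuousOn.norm.pow 2).intervalIntegrable_of_Icc ht.2).const_mul _) fun s _ => ?_
    simpa [stageCost] using h.inner_Q_le s (y s)
  have hvalue := hx.inner_le_of_trajectory h ht.1 ht.2 le_rfl hy hyt
  rw [hb] at hvalue
  calc inner ℝ (lam t) (x t) ≤ K.lamQ * ‖y b‖ ^ 2 + K.lamQ * ∫ s in t..b, ‖y s‖ ^ 2 := by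
        linarith [hG.two_mul_inner_sub_le h.toPositive (x b) (y b)]
    _ ≤ K.lamQ * (‖x t‖ ^ 2 * Real.exp (2 * K.growth * K.σ)) +
          K.lamQ * (‖x t‖ ^ 2 * K.dualα₁) := by gcongr
    _ = K.lamQ * (Real.exp (2 * K.growth * K.σ) + K.dualα₁) * ‖x t‖ ^ 2 := by ring
    _ ≤ K.c₁ * ‖x t‖ ^ 2 := by gcongr; exact h.terminal_le_c₁

section Gramian

theorem continuous_evolution_comp (hP : ContinuousCoefficients P) (t : ℝ) :
    Continuous fun s => evolution P.A t s ∘L P.B s :=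
  (continuous_evolution_right hP.contA t).clm_comp hP.contB

theorem gramian_apply (hP : ContinuousCoefficients P) (t s : ℝ) (x : Vec nx) :
    gramian P.A P.B t s x = ∫ r in t..s, (evolution P.A t r ∘L P.B r)
      ((evolution P.A t r ∘L P.B r).adjoint x) := by
  have hc := continuous_evolution_comp hP t
  exact (ContinuousLinearMap.intervalIntegral_comp_comm (ContinuousLinearMap.apply ℝ (Vec nx) x)
    ((hc.clm_comp (continuous_adjoint_comp hc)).intervalIntegrable t s)).symm

theorem inner_gramian (hP : ContinuousCoefficients P) (t s : ℝ) (x y : Vec nx) :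
    inner ℝ y (gramian P.A P.B t s x) =
      ∫ r in t..s, inner ℝ ((evolution P.A t r ∘L P.B r).adjoint y)
        ((evolution P.A t r ∘L P.B r).adjoint x) := by
  have hc := continuous_evolution_comp hP t
  have hint := (hc.clm_apply ((continuous_adjoint_comp hc).clm_apply
    (continuous_const (y := x)))).intervalIntegrable (μ := volume) t s
  simp only [gramian_apply hP, ContinuousLinearMap.adjoint_inner_left]
  exact ((innerSL ℝ y).intervalIntegral_comp_comm hint).symm

theorem inner_gramian_symm (hP : ContinuousCoefficients P) (t s : ℝ) (x y : Vec nx) :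
    inner ℝ (gramian P.A P.B t s x) y = inner ℝ x (gramian P.A P.B t s y) := by
  rw [real_inner_comm, inner_gramian hP, inner_gramian hP]
  exact intervalIntegral.integral_congr fun r _ => real_inner_comm _ _

theorem inner_gramian_self (hP : ContinuousCoefficients P) (t s : ℝ) (x : Vec nx) :
    inner ℝ x (gramian P.A P.B t s x) =
      ∫ r in t..s, ‖(evolution P.A t r ∘L P.B r).adjoint x‖ ^ 2 := by
  simp only [inner_gramian hP, real_inner_self_eq_norm_sq]

theorem inner_gramian_nonneg (hP : ContinuousCoefficients P) {t s : ℝ} (hts : t ≤ s)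
    (x : Vec nx) : 0 ≤ inner ℝ x (gramian P.A P.B t s x) := by
  rw [inner_gramian_self hP]
  exact intervalIntegral.integral_nonneg hts fun r _ => sq_nonneg _

theorem inner_gramian_mono (hP : ContinuousCoefficients P) {t s e : ℝ} (hts : t ≤ s)
    (hse : s ≤ e) (x : Vec nx) :
    inner ℝ x (gramian P.A P.B t s x) ≤ inner ℝ x (gramian P.A P.B t e x) := by
  rw [inner_gramian_self hP, inner_gramian_self hP]
  have hc := continuous_adjoint_comp (continuous_evolution_comp hP t)
  exact intervalIntegral.integral_mono_interval le_rfl hts hse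
    (Filter.Eventually.of_forall fun r => sq_nonneg _)
    (((hc.clm_apply continuous_const).norm.pow 2).intervalIntegrable t e)

theorem norm_adjoint_evolution_comp_le (h : Regular P K) {t s : ℝ} (hts : t ≤ s) (x : Vec nx) :
    ‖(evolution P.A t s ∘L P.B s).adjoint x‖ ≤
      K.lamB * ‖x‖ * Real.exp (K.growth * (s - t)) := by
  rw [mul_right_comm]
  refine ContinuousLinearMap.le_of_opNorm_le _ ?_ x
  rw [LinearIsometryEquiv.norm_map, mul_comm]
  refine (ContinuousLinearMap.opNorm_comp_le _ _).trans ?_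
  gcongr
  · refine (norm_evolution_le h.contA h.normA t s).trans ?_
    rw [abs_sub_comm, abs_of_nonneg (sub_nonneg.2 hts)]
    gcongr
    exact h.lamA_le_growth
  · exact h.normB s

theorem inner_gramian_le (h : Regular P K) {t s : ℝ} (hts : t ≤ s) (hσ : s ≤ t + K.σ)
    (x : Vec nx) : inner ℝ x (gramian P.A P.B t s x) ≤ K.α₁' * ‖x‖ ^ 2 := by
  have hc := continuous_adjoint_comp (continuous_evolution_comp h.toContinuousCoefficients t)
  rw [inner_gramian_self h.toContinuousCoefficients, K.α₁'_eq, mul_right_comm, ← mul_pow]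
  exact integral_sq_norm_le_of_norm_le_exp h.growth_pos hts hσ
    (hc.clm_apply continuous_const).continuousOn
    fun r hr => norm_adjoint_evolution_comp_le h hr.1 x

end Gramian

/-- The control of least energy among those that steer the state from `x` at time `t` to `0` at
time `e`, in terms of the controllability Gramian. -/
def steering (P : Problem nx nu) (t e : ℝ) (x : Vec nx) (r : ℝ) : Vec nu :=
  -(evolution P.A t r ∘L P.B r).adjoint ((gramian P.A P.B t e).inverse x)

section Steering

theorem continuous_steering (hP : ContinuousCoefficients P) (t e : ℝ) (x : Vec nx) :
    Continuous (steering P t e x) :=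
  ((continuous_adjoint_comp (continuous_evolution_comp hP t)).clm_apply continuous_const).neg

theorem response_steering (hP : ContinuousCoefficients P) (t e s : ℝ) (x : Vec nx) :
    response P t x (steering P t e x) s =
      evolution P.A s t (x - gramian P.A P.B t s ((gramian P.A P.B t e).inverse x)) := by
  simp only [response, steering, gramian_apply hP t s, map_neg, intervalIntegral.integral_neg,
    sub_eq_add_neg, ContinuousLinearMap.comp_apply]

variable {t e α : ℝ}

theorem gramian_inverse_apply (hα : 0 < α)
    (hlow : ∀ z, α * ‖z‖ ^ 2 ≤ inner ℝ z (gramian P.A P.B t e z)) (x : Vec nx) :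
    gramian P.A P.B t e ((gramian P.A P.B t e).inverse x) = x :=
  (isInvertible_of_le_inner hα hlow).self_apply_inverse x

theorem norm_gramian_inverse_apply_le (hα : 0 < α)
    (hlow : ∀ z, α * ‖z‖ ^ 2 ≤ inner ℝ z (gramian P.A P.B t e z)) (x : Vec nx) :
    ‖(gramian P.A P.B t e).inverse x‖ ≤ ‖x‖ / α := by
  simpa only [gramian_inverse_apply hα hlow] using
    norm_le_of_le_inner hα hlow ((gramian P.A P.B t e).inverse x)

theorem response_steering_end (hα : 0 < α)
    (hlow : ∀ z, α * ‖z‖ ^ 2 ≤ inner ℝ z (gramian P.A P.B t e z))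
    (hP : ContinuousCoefficients P) (x : Vec nx) :
    response P t x (steering P t e x) e = 0 := by
  rw [response_steering hP, gramian_inverse_apply hα hlow, sub_self, map_zero]

theorem integral_sq_norm_steering_le (hα : 0 < α)
    (hlow : ∀ z, α * ‖z‖ ^ 2 ≤ inner ℝ z (gramian P.A P.B t e z))
    (hP : ContinuousCoefficients P) (x : Vec nx) :
    ∫ r in t..e, ‖steering P t e x r‖ ^ 2 ≤ ‖x‖ ^ 2 / α := by
  simp only [steering, norm_neg]
  rw [← inner_gramian_self hP, gramian_inverse_apply hα hlow]
  calc inner ℝ ((gramian P.A P.B t e).inverse x) x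
      ≤ ‖(gramian P.A P.B t e).inverse x‖ * ‖x‖ := real_inner_le_norm _ _
    _ ≤ ‖x‖ / α * ‖x‖ := by gcongr; exact norm_gramian_inverse_apply_le hα hlow x
    _ = ‖x‖ ^ 2 / α := by ring

theorem norm_response_steering_le (hα : 0 < α)
    (hlow : ∀ z, α * ‖z‖ ^ 2 ≤ inner ℝ z (gramian P.A P.B t e z))
    (h : Regular P K) {s κ c : ℝ} (hs : s ∈ Icc t e)
    (hκ : 0 ≤ κ) (hup : ∀ z, inner ℝ z (gramian P.A P.B t e z) ≤ κ * ‖z‖ ^ 2)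
    (hc : K.lamA ≤ c) (x : Vec nx) :
    ‖response P t x (steering P t e x) s‖ ≤
      (1 + κ / α) * ‖x‖ * Real.exp (c * (s - t)) := by
  have hP := h.toContinuousCoefficients
  have hnorm : ‖gramian P.A P.B t s‖ ≤ κ :=
    norm_le_of_inner_le hκ (inner_gramian_symm hP t s) (inner_gramian_nonneg hP hs.1)
      fun z => (inner_gramian_mono hP hs.1 hs.2 z).trans (hup z)
  rw [response_steering hP, mul_comm]
  refine (norm_evolution_apply_le h hs.1 hc _).trans ?_
  gcongr
  calc _ ≤ ‖x‖ + ‖gramian P.A P.B t s ((gramian P.A P.B t e).inverse x)‖ := norm_sub_le _ _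
    _ ≤ ‖x‖ + κ * (‖x‖ / α) := by
        gcongr
        refine (ContinuousLinearMap.le_of_opNorm_le _ hnorm _).trans ?_
        gcongr
        exact norm_gramian_inverse_apply_le hα hlow x
    _ = (1 + κ / α) * ‖x‖ := by ring

theorem integral_sq_norm_response_steering_le (hα : 0 < α)
    (hlow : ∀ z, α * ‖z‖ ^ 2 ≤ inner ℝ z (gramian P.A P.B t e z))
    (h : Regular P K) {κ c : ℝ} (hte : t ≤ e)
    (heσ : e ≤ t + K.σ) (hκ : 0 ≤ κ)
    (hup : ∀ z, inner ℝ z (gramian P.A P.B t e z) ≤ κ * ‖z‖ ^ 2) (hc : K.lamA ≤ c)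
    (x : Vec nx) :
    ∫ s in t..e, ‖response P t x (steering P t e x) s‖ ^ 2 ≤
      ((1 + κ / α) * ‖x‖) ^ 2 * ((Real.exp (2 * c * K.σ) - 1) / (2 * c)) :=
  integral_sq_norm_le_of_norm_le_exp (h.lamA_pos.trans_le hc) hte heσ
    (IsTrajectory.response h.toContinuousCoefficients t e x
      (continuous_steering h.toContinuousCoefficients t e x)).continuousOn
    fun _ hs => norm_response_steering_le hα hlow h hs hκ hup hc x

end Steering

theorem integral_stageCost_steering_le (h : Regular P K) {t e : ℝ} (hte : t ≤ e)
    (heσ : e ≤ t + K.σ) (hlow : ∀ z, K.α₀ * ‖z‖ ^ 2 ≤ inner ℝ z (gramian P.A P.B t e z))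
    (hup : ∀ z, inner ℝ z (gramian P.A P.B t e z) ≤ K.α₁ * ‖z‖ ^ 2) (x : Vec nx) :
    ∫ s in t..e, stageCost P s (response P t x (steering P t e x) s) (steering P t e x s) ≤
      (K.lamQ * ((1 + K.α₁' / K.α₀') ^ 2 * K.dualα₁) + K.lamR * K.α₀'⁻¹) * ‖x‖ ^ 2 := by
  have hP := h.toContinuousCoefficients
  have hα₀ := h.α₀_pos
  have hA := h.lamA_pos
  have := h.lamQ_pos
  have := h.lamR_pos
  have := h.α₀'_pos
  have := h.α₁'_nonneg
  have := h.dualα₁_nonneg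
  have hcost := integral_stageCost_le h hte
    (IsTrajectory.response hP t e x (continuous_steering hP t e x))
  have henergy := integral_sq_norm_steering_le hα₀ hlow hP x
  have hstate := integral_sq_norm_response_steering_le hα₀ hlow h hte heσ h.α₁_pos.le hup le_rfl x
  have hstate' : ∫ s in t..e, ‖response P t x (steering P t e x) s‖ ^ 2 ≤
      ((1 + K.α₁' / K.α₀') * ‖x‖) ^ 2 * K.dualα₁ :=
    (integral_sq_norm_response_steering_le hα₀ hlow h hte heσ h.α₁'_nonneg
      (inner_gramian_le h hte heσ) h.lamA_le_growth x).trans (by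
        change _ * K.dualα₁ ≤ _
        gcongr
        exact h.α₀'_le)
  calc _ ≤ K.lamQ * (((1 + K.α₁' / K.α₀') * ‖x‖) ^ 2 * K.dualα₁) +
        K.lamR * (2 * (‖x‖ ^ 2 / K.α₀) + 2 * (K.lamH / K.gamR) ^ 2 *
          (((1 + K.α₁ / K.α₀) * ‖x‖) ^ 2 *
            ((Real.exp (2 * K.lamA * K.σ) - 1) / (2 * K.lamA)))) := hcost.trans (by gcongr)
    _ = _ := by
        rw [Constants.α₀', inv_inv]
        generalize (K.lamH / K.gamR) ^ 2 = w, K.α₁' / _ = w'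
        field_simp

namespace IsExtremal

variable {a b : ℝ} {x lam : ℝ → Vec nx} {u : ℝ → Vec nu} {G : Vec nx →L[ℝ] Vec nx}

theorem inner_le_interior (h : Regular P K) (hW : GramianBounds P K) (ha : 0 ≤ a)
    (hbT : b ≤ P.T) (hx : IsExtremal P a b x u lam) (hG : TerminalWeight K G)
    (hb : lam b = G (x b)) {t : ℝ} (hat : a ≤ t) (htb : t + K.σ ≤ b) :
    inner ℝ (lam t) (x t) ≤ K.c₁ * ‖x t‖ ^ 2 := by
  rcases eq_or_ne (x t) 0 with hzero | hne
  · simp [hzero]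
  have hP := h.toContinuousCoefficients
  obtain ⟨e, ⟨hte, heσ⟩, hW₀, hW₁⟩ := hW t ⟨ha.trans hat, by linarith⟩
  have heb : e ≤ b := heσ.trans htb
  have hlow := (smul_one_le_iff.1 hW₀).2
  have hα : K.α₀ ≤ K.α₁' :=
    le_of_mul_le_mul_right ((hlow (x t)).trans (inner_gramian_le h hte heσ (x t)))
      (pow_pos (norm_pos_iff.2 hne) 2)
  have hy := IsTrajectory.response hP t e (x t) (continuous_steering hP t e (x t))
  have hvalue := hx.inner_le_of_trajectory h hat hte heb hy (response_self t (x t) _)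
  rw [response_steering_end h.α₀_pos hlow hP, inner_zero_right] at hvalue
  have hnonneg := hx.inner_nonneg h hG hb ⟨hat.trans hte, heb⟩
  calc inner ℝ (lam t) (x t)
      ≤ (K.lamQ * ((1 + K.α₁' / K.α₀') ^ 2 * K.dualα₁) + K.lamR * K.α₀'⁻¹) * ‖x t‖ ^ 2 := by
        linarith [integral_stageCost_steering_le h hte heσ hlow (inner_le_of_le_smul_one hW₁) (x t)]
    _ ≤ K.c₁ * ‖x t‖ ^ 2 := by gcongr; exact h.interior_le_c₁ hα

theorem inner_le_c₁_mul (h : Regular P K) (hW : GramianBounds P K) (ha : 0 ≤ a)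
    (hbT : b ≤ P.T) (hx : IsExtremal P a b x u lam) (hG : TerminalWeight K G)
    (hb : lam b = G (x b)) {t : ℝ} (ht : t ∈ Icc a b) :
    inner ℝ (lam t) (x t) ≤ K.c₁ * ‖x t‖ ^ 2 := by
  rcases le_total (t + K.σ) b with hinterior | hterminal
  · exact hx.inner_le_interior h hW ha hbT hG hb ht.1 hinterior
  · exact hx.inner_le_near_end h hG hb ht hterminal

end IsExtremal

end

/-! ### Exponential decay -/

section

section Calculus

theorem isInvertible_of_injective {E : Type*} [NormedAddCommGroup E] [NormedSpace ℝ E]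
    [FiniteDimensional ℝ E] {F : E →L[ℝ] E} (hF : Function.Injective F) : F.IsInvertible :=
  ⟨(LinearEquiv.ofInjectiveEndo (F : E →ₗ[ℝ] E) hF).toContinuousLinearEquiv,
    ContinuousLinearMap.ext fun _ => rfl⟩

theorem hasDerivWithinAt_inverse_apply {E : Type*} [NormedAddCommGroup E] [NormedSpace ℝ E]
    [CompleteSpace E] {F : ℝ → E →L[ℝ] E} {F' : E →L[ℝ] E} {x : ℝ → E} {x' : E} {s : Set ℝ}
    {t : ℝ} (hinv : (F t).IsInvertible) (hF : HasDerivWithinAt F F' s t)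
    (hx : HasDerivWithinAt x x' s t) :
    HasDerivWithinAt (fun t => (F t).inverse (x t))
      ((F t).inverse (x' - F' ((F t).inverse (x t)))) s t := by
  obtain ⟨e, he⟩ := hinv
  have hunit : IsUnit (F t) := ⟨e.toUnit, he⟩
  have hinverse := hasFDerivAt_ringInverse (𝕜 := ℝ) hunit.unit
  rw [hunit.unit_spec, ContinuousLinearMap.ringInverse_eq_inverse] at hinverse
  refine ((hinverse.comp_hasDerivWithinAt t hF).clm_apply hx).congr_deriv ?_
  rw [← Ring.inverse_unit, hunit.unit_spec, ContinuousLinearMap.ringInverse_eq_inverse]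
  simp only [neg_apply, ContinuousLinearMap.mulLeftRight_apply, mul_apply_eq_comp,
    Function.comp_apply, map_sub]
  abel

theorem hasDerivAt_exp_mul_sub (c t s : ℝ) :
    HasDerivAt (fun s => Real.exp (c * (s - t))) (c * Real.exp (c * (s - t))) s := by
  simpa only [id, mul_one, mul_comm (Real.exp _)] using
    (((hasDerivAt_id s).sub_const t).const_mul c).exp

theorem norm_le_add_of_norm_deriv_le_exp {E : Type*} [NormedAddCommGroup E] [NormedSpace ℝ E]
    {f f' : ℝ → E} {a t c d C : ℝ} (hat : a ≤ t) (hc : 0 < c) (hC : 0 ≤ C)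
    (hf : ∀ s ∈ Icc a t, HasDerivWithinAt f (f' s) (Icc a t) s)
    (hle : ∀ s ∈ Icc a t, ‖f' s‖ ≤ C * Real.exp (c * (s - d))) :
    ‖f t‖ ≤ ‖f a‖ + C / c * Real.exp (c * (t - d)) := by
  have hbound := image_norm_le_of_norm_deriv_right_le_deriv_boundary' (f := f)
    (B := fun s => ‖f a‖ + C / c * (Real.exp (c * (s - d)) - Real.exp (c * (a - d))))
    (B' := fun s => C / c * (c * Real.exp (c * (s - d))))
    (fun s hs => (hf s hs).continuousWithinAt)
    (fun s hs => (hf s (Ico_subset_Icc_self hs)).mono_of_mem_nhdsWithin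
      (Icc_mem_nhdsGE_of_mem hs))
    (by rw [sub_self, mul_zero, add_zero]) (Continuous.continuousOn (by fun_prop))
    (fun s _ => ((((hasDerivAt_exp_mul_sub c d s).sub_const _).const_mul _).const_add
      _).hasDerivWithinAt)
    (fun s hs => by
      rw [← mul_assoc, div_mul_cancel₀ _ hc.ne']
      exact hle s (Ico_subset_Icc_self hs)) (right_mem_Icc.2 hat)
  refine hbound.trans ?_
  gcongr
  exact sub_le_self _ (Real.exp_pos _).le

end Calculus

variable {nx nu : ℕ} {P : Problem nx nu} {K : Constants}

namespace Constants.Positive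

theorem ρZ_pos (hK : K.Positive) : 0 < K.ρZ :=
  div_pos hK.gamQ_pos (mul_pos two_pos hK.c₁_pos)

theorem two_mul_ρZ_mul_c₁ (hK : K.Positive) : 2 * K.ρZ * K.c₁ = K.gamQ := by
  have := hK.c₁_pos
  rw [Constants.ρZ]
  field_simp

theorem cZ_pos (hK : K.Positive) : 0 < K.cZ :=
  Real.sqrt_pos.2 (div_pos hK.c₁_pos hK.c₀_pos)

theorem sq_cZ (hK : K.Positive) : K.cZ ^ 2 = K.c₁ / K.c₀ :=
  Real.sq_sqrt (div_pos hK.c₁_pos hK.c₀_pos).le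

end Constants.Positive

theorem Regular.stagePolar_comm (h : Regular P K) (t : ℝ) (x y : Vec nx) (u v : Vec nu) :
    stagePolar P t x u y v = stagePolar P t y v x u := by
  simp only [stagePolar, inner_add_right, ContinuousLinearMap.adjoint_inner_right,
    real_inner_comm u (P.H t y), real_inner_comm v (P.H t x), ← h.inner_Q_symm t x y,
    real_inner_comm y (P.Q t x), ← h.inner_R_symm t u v, real_inner_comm v (P.R t u)]
  ring

namespace IsExtremal

variable {a b : ℝ} {x y lam mu : ℝ → Vec nx} {u v : ℝ → Vec nu} {G : Vec nx →L[ℝ] Vec nx}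

theorem inner_sub_inner_eq (h : Regular P K) (hx : IsExtremal P a b x u lam)
    (hy : IsExtremal P a b y v mu) {t : ℝ} (ht : t ∈ Icc a b) :
    inner ℝ (lam t) (y t) - inner ℝ (mu t) (x t) =
      inner ℝ (lam b) (y b) - inner ℝ (mu b) (x b) := by
  have hpair : ∀ s ∈ Icc a b, HasDerivWithinAt
      (fun s => inner ℝ (lam s) (y s) - inner ℝ (mu s) (x s)) 0 (Icc a b) s := fun s hs => by
    refine ((hx.hasDerivWithinAt_inner hy.trajectory hs).sub
      (hy.hasDerivWithinAt_inner hx.trajectory hs)).congr_deriv ?_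
    rw [h.stagePolar_comm, sub_self]
  have hconst := constant_of_has_deriv_right_zero (fun s hs => (hpair s hs).continuousWithinAt)
    fun s hs => (hpair s (Ico_subset_Icc_self hs)).mono_of_mem_nhdsWithin
      (Icc_mem_nhdsGE_of_mem hs)
  exact (hconst t ht).trans (hconst b (right_mem_Icc.2 (ht.1.trans ht.2))).symm

theorem exp_mul_inner_le (h : Regular P K) (hW : GramianBounds P K) (ha : 0 ≤ a) (hbT : b ≤ P.T)
    (hx : IsExtremal P a b x u lam) (hG : TerminalWeight K G) (hb : lam b = G (x b)) {s t : ℝ}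
    (has : a ≤ s) (hst : s ≤ t) (htb : t ≤ b) :
    Real.exp (2 * K.ρZ * (t - s)) * inner ℝ (lam t) (x t) ≤ inner ℝ (lam s) (x s) := by
  have hdecay : ∀ r ∈ Icc s t,
      2 * K.ρZ * Real.exp (2 * K.ρZ * (r - s)) * inner ℝ (lam r) (x r) +
        Real.exp (2 * K.ρZ * (r - s)) * -stageCost P r (x r) (u r) ≤ 0 := by
    intro r hr
    have hrate : 2 * K.ρZ * inner ℝ (lam r) (x r) ≤ stageCost P r (x r) (u r) :=
      calc 2 * K.ρZ * inner ℝ (lam r) (x r) ≤ 2 * K.ρZ * (K.c₁ * ‖x r‖ ^ 2) := by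
            have := h.ρZ_pos
            gcongr
            exact hx.inner_le_c₁_mul h hW ha hbT hG hb ⟨has.trans hr.1, hr.2.trans htb⟩
        _ = K.gamQ * ‖x r‖ ^ 2 := by rw [← mul_assoc, h.two_mul_ρZ_mul_c₁]
        _ ≤ stageCost P r (x r) (u r) := h.gamQ_le_stageCost r (x r) (u r)
    linarith [mul_le_mul_of_nonneg_left hrate (Real.exp_pos (2 * K.ρZ * (r - s))).le]
  have hmono := sub_le_sub_of_hasDerivWithinAt_le hst
    (fun r hr => (hasDerivAt_exp_mul_sub (2 * K.ρZ) s r).hasDerivWithinAt.mul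
      ((hx.mono has htb).hasDerivWithinAt_inner_self hr))
    (fun r _ => hasDerivWithinAt_const r (Icc s t) (0 : ℝ)) hdecay
  simp only [Pi.mul_apply, sub_self, mul_zero, Real.exp_zero, one_mul] at hmono
  linarith

theorem norm_le_exp_mul (h : Regular P K) (hW : GramianBounds P K) (ha : 0 ≤ a) (hbT : b ≤ P.T)
    (hx : IsExtremal P a b x u lam) (hG : TerminalWeight K G) (hb : lam b = G (x b)) {s t : ℝ}
    (has : a ≤ s) (hst : s ≤ t) (htb : t ≤ b) :
    ‖x t‖ ≤ K.cZ * Real.exp (-K.ρZ * (t - s)) * ‖x s‖ := by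
  have hc₀ := h.c₀_pos
  have hcZ := h.cZ_pos
  have hexp : Real.exp (2 * K.ρZ * (t - s)) * (K.c₀ * ‖x t‖ ^ 2) ≤ K.c₁ * ‖x s‖ ^ 2 :=
    calc Real.exp (2 * K.ρZ * (t - s)) * (K.c₀ * ‖x t‖ ^ 2)
        ≤ Real.exp (2 * K.ρZ * (t - s)) * inner ℝ (lam t) (x t) := by
          gcongr
          exact hx.c₀_mul_le_inner h hG hb ⟨has.trans hst, htb⟩
      _ ≤ inner ℝ (lam s) (x s) := hx.exp_mul_inner_le h hW ha hbT hG hb has hst htb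
      _ ≤ K.c₁ * ‖x s‖ ^ 2 := hx.inner_le_c₁_mul h hW ha hbT hG hb ⟨has, hst.trans htb⟩
  have hsq_exp : Real.exp (-K.ρZ * (t - s)) ^ 2 = (Real.exp (2 * K.ρZ * (t - s)))⁻¹ := by
    rw [← Real.exp_nat_mul, ← Real.exp_neg]
    ring_nf
  refine le_of_sq_le_sq ?_ (by positivity)
  rw [mul_pow, mul_pow, h.sq_cZ, hsq_exp]
  calc ‖x t‖ ^ 2 = (Real.exp (2 * K.ρZ * (t - s)))⁻¹ *
        (Real.exp (2 * K.ρZ * (t - s)) * (K.c₀ * ‖x t‖ ^ 2)) / K.c₀ := by field_simp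
    _ ≤ (Real.exp (2 * K.ρZ * (t - s)))⁻¹ * (K.c₁ * ‖x s‖ ^ 2) / K.c₀ := by gcongr
    _ = K.c₁ / K.c₀ * (Real.exp (2 * K.ρZ * (t - s)))⁻¹ * ‖x s‖ ^ 2 := by ring

end IsExtremal

/-- The control `-R⁻¹(Hx + Bᵀλ)` that makes the Hamiltonian stationary at `(x, λ)`. -/
def feedback (P : Problem nx nu) (t : ℝ) : Vec nx × Vec nx →L[ℝ] Vec nu :=
  -(P.R t).inverse ∘L
    (P.H t ∘L .fst ℝ (Vec nx) (Vec nx) + (P.B t).adjoint ∘L .snd ℝ (Vec nx) (Vec nx))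

/-- The coefficient of the Hamiltonian system, the linear differential equation for `(x, λ)` left
after eliminating the control by `feedback`. -/
def hamiltonian (P : Problem nx nu) (t : ℝ) : Vec nx × Vec nx →L[ℝ] Vec nx × Vec nx :=
  (P.A t ∘L .fst ℝ (Vec nx) (Vec nx) + P.B t ∘L feedback P t).prod
    (-(P.Q t ∘L .fst ℝ (Vec nx) (Vec nx) + (P.H t).adjoint ∘L feedback P t +
      (P.A t).adjoint ∘L .snd ℝ (Vec nx) (Vec nx)))

/-- The matrix solution `(X, Λ)` of the Hamiltonian system with `X(b) = I` and `Λ(b) = G`. -/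
def hamiltonianFlow (P : Problem nx nu) (G : Vec nx →L[ℝ] Vec nx) (b t : ℝ) :
    Vec nx →L[ℝ] Vec nx × Vec nx :=
  LinearODE.fundamental (hamiltonian P) t b ∘L (ContinuousLinearMap.id ℝ (Vec nx)).prod G

/-- The component `X` of `hamiltonianFlow`. -/
def stateFlow (P : Problem nx nu) (G : Vec nx →L[ℝ] Vec nx) (b t : ℝ) : Vec nx →L[ℝ] Vec nx :=
  .fst ℝ (Vec nx) (Vec nx) ∘L hamiltonianFlow P G b t

/-- The component `Λ` of `hamiltonianFlow`. -/
def costateFlow (P : Problem nx nu) (G : Vec nx →L[ℝ] Vec nx) (b t : ℝ) : Vec nx →L[ℝ] Vec nx :=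
  .snd ℝ (Vec nx) (Vec nx) ∘L hamiltonianFlow P G b t

/-- The Riccati matrix `S = ΛX⁻¹`: the homogeneous terminal condition `λ(b) = Gx(b)` propagates to
`λ = Sx`. -/
def riccati (P : Problem nx nu) (G : Vec nx →L[ℝ] Vec nx) (b t : ℝ) : Vec nx →L[ℝ] Vec nx :=
  costateFlow P G b t ∘L (stateFlow P G b t).inverse

/-- The evolution operator `X(t)X(s)⁻¹` of the closed-loop system, in which the control is
`feedback` at `λ = Sx`. -/
def closedLoop (P : Problem nx nu) (G : Vec nx →L[ℝ] Vec nx) (b t s : ℝ) : Vec nx →L[ℝ] Vec nx :=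
  stateFlow P G b t ∘L (stateFlow P G b s).inverse

namespace Regular

theorem norm_adjoint_B_apply_le (h : Regular P K) (t : ℝ) (x : Vec nx) :
    ‖(P.B t).adjoint x‖ ≤ K.lamB * ‖x‖ := by
  refine ContinuousLinearMap.le_of_opNorm_le _ ?_ x
  rw [LinearIsometryEquiv.norm_map]
  exact h.normB t

theorem norm_feedback_le (h : Regular P K) (t : ℝ) (z : Vec nx × Vec nx) :
    ‖feedback P t z‖ ≤ K.lamH / K.gamR * ‖z.1‖ + K.lamB / K.gamR * ‖z.2‖ := by
  have hr := h.gamR_pos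
  calc ‖feedback P t z‖ = ‖(P.R t).inverse (P.H t z.1 + (P.B t).adjoint z.2)‖ := norm_neg _
    _ ≤ ‖P.H t z.1 + (P.B t).adjoint z.2‖ / K.gamR := h.norm_R_inverse_apply_le t _
    _ ≤ (K.lamH * ‖z.1‖ + K.lamB * ‖z.2‖) / K.gamR := by
        gcongr
        exact (norm_add_le _ _).trans (add_le_add ((P.H t).le_of_opNorm_le (h.normH t) _)
          (h.norm_adjoint_B_apply_le t _))
    _ = K.lamH / K.gamR * ‖z.1‖ + K.lamB / K.gamR * ‖z.2‖ := by ring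

theorem continuous_feedback (h : Regular P K) : Continuous (feedback P) :=
  (h.continuous_R_inverse.clm_comp ((h.contH.clm_comp continuous_const).add
    ((continuous_adjoint_comp h.contB).clm_comp continuous_const))).neg

theorem continuous_hamiltonian (h : Regular P K) : Continuous (hamiltonian P) :=
  have hfeedback := h.continuous_feedback
  (ContinuousLinearMap.prodₗᵢ ℝ).continuous.comp
    (((h.contA.clm_comp continuous_const).add (h.contB.clm_comp hfeedback)).prodMk
      (((h.contQ.clm_comp continuous_const).add
        ((continuous_adjoint_comp h.contH).clm_comp hfeedback)).add
        ((continuous_adjoint_comp h.contA).clm_comp continuous_const)).neg)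

theorem hasDerivAt_hamiltonianFlow (h : Regular P K) (G : Vec nx →L[ℝ] Vec nx) (b t : ℝ) :
    HasDerivAt (hamiltonianFlow P G b) (hamiltonian P t ∘L hamiltonianFlow P G b t) t :=
  ((LinearODE.hasDerivAt_fundamental h.continuous_hamiltonian t b).clm_comp
    (hasDerivAt_const t _)).congr_deriv (by rw [ContinuousLinearMap.comp_zero, add_zero]; rfl)

theorem hasDerivAt_stateFlow (h : Regular P K) (G : Vec nx →L[ℝ] Vec nx) (b t : ℝ) :
    HasDerivAt (stateFlow P G b) (P.A t ∘L stateFlow P G b t +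
      P.B t ∘L feedback P t ∘L hamiltonianFlow P G b t) t := by
  refine ((hasDerivAt_const t (ContinuousLinearMap.fst ℝ (Vec nx) (Vec nx))).clm_comp
    (h.hasDerivAt_hamiltonianFlow G b t)).congr_deriv (ContinuousLinearMap.ext fun z => ?_)
  simp [hamiltonian, stateFlow]

theorem hasDerivAt_costateFlow (h : Regular P K) (G : Vec nx →L[ℝ] Vec nx) (b t : ℝ) :
    HasDerivAt (costateFlow P G b) (-(P.Q t ∘L stateFlow P G b t +
      (P.H t).adjoint ∘L feedback P t ∘L hamiltonianFlow P G b t +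
      (P.A t).adjoint ∘L costateFlow P G b t)) t := by
  refine ((hasDerivAt_const t (ContinuousLinearMap.snd ℝ (Vec nx) (Vec nx))).clm_comp
    (h.hasDerivAt_hamiltonianFlow G b t)).congr_deriv (ContinuousLinearMap.ext fun z => ?_)
  simp [hamiltonian, stateFlow, costateFlow]

theorem isExtremal_flow (h : Regular P K) (G : Vec nx →L[ℝ] Vec nx) (a b c : ℝ) (z : Vec nx) :
    IsExtremal P a b (fun t => stateFlow P G c t z)
      (fun t => feedback P t (hamiltonianFlow P G c t z)) (fun t => costateFlow P G c t z) where
  trajectory :=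
    { control := (h.continuous_feedback.clm_apply ((continuous_iff_continuousAt.2 fun t =>
        (h.hasDerivAt_hamiltonianFlow G c t).continuousAt).clm_apply
          continuous_const)).continuousOn
      state := fun t _ => (((h.hasDerivAt_stateFlow G c t).clm_apply
        (hasDerivAt_const t z)).congr_deriv (by rw [map_zero, add_zero]; rfl)).hasDerivWithinAt }
  costate t _ := (((h.hasDerivAt_costateFlow G c t).clm_apply
    (hasDerivAt_const t z)).congr_deriv (by rw [map_zero, add_zero]; rfl)).hasDerivWithinAt
  stationary t _ := by
    change P.R t (-(P.R t).inverse (P.H t (stateFlow P G c t z) +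
      (P.B t).adjoint (costateFlow P G c t z))) + _ + _ = 0
    rw [map_neg, h.R_inverse_apply]
    abel

end Regular

theorem hamiltonianFlow_end (G : Vec nx →L[ℝ] Vec nx) (b : ℝ) :
    hamiltonianFlow P G b b = (ContinuousLinearMap.id ℝ (Vec nx)).prod G := by
  rw [hamiltonianFlow, LinearODE.fundamental_self]
  rfl

theorem stateFlow_end (G : Vec nx →L[ℝ] Vec nx) (b : ℝ) : stateFlow P G b b = 1 := by
  rw [stateFlow, hamiltonianFlow_end]
  rfl

theorem costateFlow_end (G : Vec nx →L[ℝ] Vec nx) (b : ℝ) : costateFlow P G b b = G := by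
  rw [costateFlow, hamiltonianFlow_end]
  rfl

theorem costateFlow_end_apply (G : Vec nx →L[ℝ] Vec nx) (b : ℝ) (z : Vec nx) :
    costateFlow P G b b z = G (stateFlow P G b b z) := by
  rw [costateFlow_end, stateFlow_end, one_apply_eq_self]

namespace TerminalWeight

variable {G : Vec nx →L[ℝ] Vec nx} {b t : ℝ}

theorem isInvertible_stateFlow (hG : TerminalWeight K G) (h : Regular P K) (htb : t ≤ b) :
    (stateFlow P G b t).IsInvertible := by
  refine isInvertible_of_injective ((injective_iff_map_eq_zero _).2 fun z hz => ?_)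
  have hle := (h.isExtremal_flow G t b b z).le_inner_terminal h hG (costateFlow_end_apply G b z)
    (left_mem_Icc.2 htb)
  rw [hz, inner_zero_right, stateFlow_end, one_apply_eq_self] at hle
  have hsq : ‖z‖ ^ 2 ≤ 0 := nonpos_of_mul_nonpos_right hle h.gamQ_pos
  exact norm_eq_zero.1 (pow_eq_zero_iff two_ne_zero |>.1 (le_antisymm hsq (sq_nonneg _)))

theorem closedLoop_self_apply (hG : TerminalWeight K G) (h : Regular P K) (htb : t ≤ b)
    (z : Vec nx) : closedLoop P G b t t z = z :=
  (hG.isInvertible_stateFlow h htb).self_apply_inverse z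

theorem norm_closedLoop_le (hG : TerminalWeight K G) (h : Regular P K) (hW : GramianBounds P K)
    (hbT : b ≤ P.T) {s : ℝ} (hs : 0 ≤ s) (hst : s ≤ t) (htb : t ≤ b) :
    ‖closedLoop P G b t s‖ ≤ K.cZ * Real.exp (-K.ρZ * (t - s)) := by
  have := h.cZ_pos
  refine ContinuousLinearMap.opNorm_le_bound _ (by positivity) fun z => ?_
  have hdecay := (h.isExtremal_flow G s b b ((stateFlow P G b s).inverse z)).norm_le_exp_mul h hW
    hs hbT hG (costateFlow_end_apply G b _) le_rfl hst htb
  rwa [(hG.isInvertible_stateFlow h (hst.trans htb)).self_apply_inverse] at hdecay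

theorem inner_riccati_symm (hG : TerminalWeight K G) (h : Regular P K) (htb : t ≤ b)
    (y z : Vec nx) :
    inner ℝ (riccati P G b t y) z = inner ℝ y (riccati P G b t z) := by
  have hpair := (h.isExtremal_flow G t b b ((stateFlow P G b t).inverse y)).inner_sub_inner_eq h
    (h.isExtremal_flow G t b b ((stateFlow P G b t).inverse z)) (left_mem_Icc.2 htb)
  simp only [(hG.isInvertible_stateFlow h htb).self_apply_inverse, stateFlow_end, costateFlow_end,
    one_apply_eq_self] at hpair
  rw [hG.symm, real_inner_comm _ (G _), sub_self, sub_eq_zero] at hpair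
  exact hpair.trans (real_inner_comm _ _)

theorem norm_riccati_le (hG : TerminalWeight K G) (h : Regular P K) (hW : GramianBounds P K)
    (hbT : b ≤ P.T) (ht : 0 ≤ t) (htb : t ≤ b) : ‖riccati P G b t‖ ≤ K.c₁ := by
  have hinv := (hG.isInvertible_stateFlow h htb).self_apply_inverse
  have hflow (z : Vec nx) := h.isExtremal_flow G t b b ((stateFlow P G b t).inverse z)
  refine norm_le_of_inner_le h.c₁_pos.le (hG.inner_riccati_symm h htb) (fun z => ?_) fun z => ?_
  · simpa only [riccati, ContinuousLinearMap.comp_apply, hinv, real_inner_comm] using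
      (hflow z).inner_nonneg h hG (costateFlow_end_apply G b _) (left_mem_Icc.2 htb)
  · simpa only [riccati, ContinuousLinearMap.comp_apply, hinv, real_inner_comm] using
      (hflow z).inner_le_c₁_mul h hW ht hbT hG (costateFlow_end_apply G b _) (left_mem_Icc.2 htb)

end TerminalWeight

namespace IsExtremal

variable {a b t : ℝ} {x lam : ℝ → Vec nx} {u : ℝ → Vec nu} {G : Vec nx →L[ℝ] Vec nx}

theorem defect_eq_adjoint_closedLoop (h : Regular P K) (hx : IsExtremal P a b x u lam)
    (hG : TerminalWeight K G) (ht : t ∈ Icc a b) :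
    lam t - riccati P G b t (x t) = (closedLoop P G b b t).adjoint (lam b - G (x b)) := by
  refine ext_inner_right ℝ fun z => ?_
  have hpair := (hx.mono ht.1 le_rfl).inner_sub_inner_eq h
    (h.isExtremal_flow G t b b ((stateFlow P G b t).inverse z)) (left_mem_Icc.2 ht.2)
  rw [(hG.isInvertible_stateFlow h ht.2).self_apply_inverse, costateFlow_end_apply, hG.symm,
    real_inner_comm (G (x b)), ← inner_sub_left] at hpair
  rw [ContinuousLinearMap.adjoint_inner_left, inner_sub_left, hG.inner_riccati_symm h ht.2,
    real_inner_comm (riccati P G b t z)]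
  exact hpair

theorem norm_defect_le (h : Regular P K) (hW : GramianBounds P K) (ha : 0 ≤ a) (hbT : b ≤ P.T)
    (hx : IsExtremal P a b x u lam) (hG : TerminalWeight K G) (ht : t ∈ Icc a b) :
    ‖lam t - riccati P G b t (x t)‖ ≤
      K.cZ * Real.exp (-K.ρZ * (b - t)) * ‖lam b - G (x b)‖ := by
  rw [hx.defect_eq_adjoint_closedLoop h hG ht]
  refine ContinuousLinearMap.le_of_opNorm_le _ ?_ _
  rw [LinearIsometryEquiv.norm_map]
  exact hG.norm_closedLoop_le h hW hbT (ha.trans ht.1) ht.2 le_rfl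

theorem control_eq_feedback (h : Regular P K) (hx : IsExtremal P a b x u lam)
    (ht : t ∈ Icc a b) : u t = feedback P t (x t, lam t) :=
  hx.control_eq h ht

theorem hasDerivWithinAt_stateFlow_inverse_apply (h : Regular P K)
    (hx : IsExtremal P a b x u lam) (hG : TerminalWeight K G) (ht : t ∈ Icc a b) :
    HasDerivWithinAt (fun t => (stateFlow P G b t).inverse (x t))
      ((stateFlow P G b t).inverse
        (P.B t (feedback P t (0, lam t - riccati P G b t (x t))))) (Icc a b) t := by
  have hinv := hG.isInvertible_stateFlow h ht.2
  refine (hasDerivWithinAt_inverse_apply hinv (h.hasDerivAt_stateFlow G b t).hasDerivWithinAt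
    (hx.trajectory.state t ht)).congr_deriv ?_
  have hflow : hamiltonianFlow P G b t ((stateFlow P G b t).inverse (x t)) =
      (x t, riccati P G b t (x t)) := Prod.ext (hinv.self_apply_inverse (x t)) rfl
  have hpair : ((0 : Vec nx), lam t - riccati P G b t (x t)) =
      (x t, lam t) - (x t, riccati P G b t (x t)) := by rw [Prod.mk_sub_mk, sub_self]
  simp only [add_apply, ContinuousLinearMap.comp_apply, hinv.self_apply_inverse, hflow,
    hx.control_eq_feedback h ht, hpair, map_sub, map_add]
  abel

theorem norm_closedLoop_defect_le (h : Regular P K) (hW : GramianBounds P K) (ha : 0 ≤ a)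
    (hbT : b ≤ P.T) (hx : IsExtremal P a b x u lam) (hG : TerminalWeight K G) {s : ℝ}
    (hs : s ∈ Icc a t) (htb : t ≤ b) :
    ‖closedLoop P G b t s (P.B s (feedback P s (0, lam s - riccati P G b s (x s))))‖ ≤
      K.cZ ^ 2 * K.lamB ^ 2 / K.gamR * ‖lam b - G (x b)‖ *
        Real.exp (2 * K.ρZ * (s - (t + b) / 2)) := by
  have := h.cZ_pos
  have := h.gamR_pos
  have := h.lamB_pos
  have hexp : Real.exp (-K.ρZ * (t - s)) * Real.exp (-K.ρZ * (b - s)) =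
      Real.exp (2 * K.ρZ * (s - (t + b) / 2)) := by
    rw [← Real.exp_add]
    ring_nf
  have hfeedback := h.norm_feedback_le s (0, lam s - riccati P G b s (x s))
  rw [norm_zero, mul_zero, zero_add] at hfeedback
  calc _ ≤ K.cZ * Real.exp (-K.ρZ * (t - s)) * (K.lamB * (K.lamB / K.gamR *
        (K.cZ * Real.exp (-K.ρZ * (b - s)) * ‖lam b - G (x b)‖))) := by
        refine ContinuousLinearMap.le_of_opNorm_le_of_le _
          (hG.norm_closedLoop_le h hW hbT (ha.trans hs.1) hs.2 htb)
          ((P.B s).le_of_opNorm_le_of_le (h.normB s) (hfeedback.trans ?_))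
        gcongr
        exact hx.norm_defect_le h hW ha hbT hG ⟨hs.1, hs.2.trans htb⟩
    _ = K.cZ ^ 2 * K.lamB ^ 2 / K.gamR * ‖lam b - G (x b)‖ *
          (Real.exp (-K.ρZ * (t - s)) * Real.exp (-K.ρZ * (b - s))) := by ring
    _ = _ := by rw [hexp]

theorem norm_state_le (h : Regular P K) (hW : GramianBounds P K) (ha : 0 ≤ a) (hbT : b ≤ P.T)
    (hx : IsExtremal P a b x u lam) (hG : TerminalWeight K G) (ht : t ∈ Icc a b) :
    ‖x t‖ ≤ K.cZ * Real.exp (-K.ρZ * (t - a)) * ‖x a‖ +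
      K.cZ ^ 2 * K.lamB ^ 2 / (2 * K.ρZ * K.gamR) * Real.exp (-K.ρZ * (b - t)) *
        ‖lam b - G (x b)‖ := by
  have hρ := h.ρZ_pos
  have hr := h.gamR_pos
  have hsub : Icc a t ⊆ Icc a b := Icc_subset_Icc_right ht.2
  have hduhamel := norm_le_add_of_norm_deriv_le_exp (f := fun s => closedLoop P G b t s (x s))
    ht.1 (mul_pos two_pos hρ) (by positivity)
    (fun s hs => (stateFlow P G b t).hasFDerivAt.comp_hasDerivWithinAt s
      ((hx.hasDerivWithinAt_stateFlow_inverse_apply h hG (hsub hs)).mono hsub))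
    fun s hs => hx.norm_closedLoop_defect_le h hW ha hbT hG hs ht.2
  rw [hG.closedLoop_self_apply h ht.2] at hduhamel
  refine hduhamel.trans (add_le_add (ContinuousLinearMap.le_of_opNorm_le _
    (hG.norm_closedLoop_le h hW hbT ha ht.1 ht.2) _) (le_of_eq ?_))
  rw [show 2 * K.ρZ * (t - (t + b) / 2) = -K.ρZ * (b - t) by ring]
  field_simp

theorem norm_state_le_max (h : Regular P K) (hW : GramianBounds P K) (ha : 0 ≤ a)
    (hbT : b ≤ P.T) (hx : IsExtremal P a b x u lam) (hG : TerminalWeight K G) {δ : ℝ}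
    (hδ : ‖lam b - G (x b)‖ ≤ K.lamQ * δ) (ht : t ∈ Icc a b) :
    ‖x t‖ ≤ max K.cZ (K.cZ ^ 2 * K.lamB ^ 2 * K.lamQ / (2 * K.ρZ * K.gamR)) *
      (Real.exp (-K.ρZ * (t - a)) * ‖x a‖ + Real.exp (-K.ρZ * (b - t)) * δ) := by
  have hρ := h.ρZ_pos
  have hr := h.gamR_pos
  have hδ₀ : 0 ≤ δ := nonneg_of_mul_nonneg_right ((norm_nonneg _).trans hδ) h.lamQ_pos
  rw [mul_add]
  calc ‖x t‖ ≤ K.cZ * Real.exp (-K.ρZ * (t - a)) * ‖x a‖ +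
        K.cZ ^ 2 * K.lamB ^ 2 / (2 * K.ρZ * K.gamR) * Real.exp (-K.ρZ * (b - t)) *
          (K.lamQ * δ) := (hx.norm_state_le h hW ha hbT hG ht).trans (by gcongr)
    _ = K.cZ * (Real.exp (-K.ρZ * (t - a)) * ‖x a‖) +
          K.cZ ^ 2 * K.lamB ^ 2 * K.lamQ / (2 * K.ρZ * K.gamR) *
            (Real.exp (-K.ρZ * (b - t)) * δ) := by ring
    _ ≤ _ := by
        gcongr
        exacts [le_max_left _ _, le_max_right _ _]

theorem norm_defect_le_max (h : Regular P K) (hW : GramianBounds P K) (ha : 0 ≤ a)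
    (hbT : b ≤ P.T) (hx : IsExtremal P a b x u lam) (hG : TerminalWeight K G) {δ : ℝ}
    (hδ : ‖lam b - G (x b)‖ ≤ K.lamQ * δ) (ht : t ∈ Icc a b) :
    ‖lam t - riccati P G b t (x t)‖ ≤
      K.lamQ * (max K.cZ (K.cZ ^ 2 * K.lamB ^ 2 * K.lamQ / (2 * K.ρZ * K.gamR)) *
        (Real.exp (-K.ρZ * (t - a)) * ‖x a‖ + Real.exp (-K.ρZ * (b - t)) * δ)) := by
  have hcZ := h.cZ_pos
  have hQ := h.lamQ_pos
  have hδ₀ : 0 ≤ δ := nonneg_of_mul_nonneg_right ((norm_nonneg _).trans hδ) hQ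
  calc ‖lam t - riccati P G b t (x t)‖
      ≤ K.cZ * Real.exp (-K.ρZ * (b - t)) * (K.lamQ * δ) :=
        (hx.norm_defect_le h hW ha hbT hG ht).trans (by gcongr)
    _ = K.lamQ * (K.cZ * (Real.exp (-K.ρZ * (b - t)) * δ)) := by ring
    _ ≤ _ := by
        gcongr
        · exact le_max_left _ _
        · exact le_add_of_nonneg_left (by positivity)

theorem norm_add_norm_add_norm_le (h : Regular P K) (hW : GramianBounds P K) (ha : 0 ≤ a)
    (hbT : b ≤ P.T) (hx : IsExtremal P a b x u lam) (hG : TerminalWeight K G) {δ : ℝ}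
    (hδ : ‖lam b - G (x b)‖ ≤ K.lamQ * δ) (ht : t ∈ Icc a b) :
    ‖x t‖ + ‖u t‖ + ‖lam t‖ ≤ K.Λb K.lamQ *
      (Real.exp (-K.ρZ * (t - a)) * ‖x a‖ + Real.exp (-K.ρZ * (b - t)) * δ) := by
  have := h.gamR_pos
  have := h.lamB_pos
  have := h.lamH_pos
  have := h.c₁_pos
  have hstate := hx.norm_state_le_max h hW ha hbT hG hδ ht
  have hdefect := hx.norm_defect_le_max h hW ha hbT hG hδ ht
  set E := Real.exp (-K.ρZ * (t - a)) * ‖x a‖ + Real.exp (-K.ρZ * (b - t)) * δ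
  set M := max K.cZ (K.cZ ^ 2 * K.lamB ^ 2 * K.lamQ / (2 * K.ρZ * K.gamR)) with hM
  have hcostate : ‖lam t‖ ≤ K.c₁ * (M * E) + K.lamQ * (M * E) :=
    calc ‖lam t‖ ≤ ‖riccati P G b t (x t)‖ + ‖lam t - riccati P G b t (x t)‖ := norm_le_insert' _ _
      _ ≤ K.c₁ * (M * E) + K.lamQ * (M * E) := add_le_add
        (ContinuousLinearMap.le_of_opNorm_le_of_le _
          (hG.norm_riccati_le h hW hbT (ha.trans ht.1) ht.2) hstate) hdefect
  have hcontrol : ‖u t‖ ≤ K.lamH / K.gamR * ‖x t‖ + K.lamB / K.gamR * ‖lam t‖ :=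
    hx.control_eq_feedback h ht ▸ h.norm_feedback_le t (x t, lam t)
  calc ‖x t‖ + ‖u t‖ + ‖lam t‖
      ≤ ‖x t‖ + (K.lamH / K.gamR * ‖x t‖ + K.lamB / K.gamR * ‖lam t‖) + ‖lam t‖ := by gcongr
    _ = (1 + K.lamH / K.gamR) * ‖x t‖ + (1 + K.lamB / K.gamR) * ‖lam t‖ := by ring
    _ ≤ (1 + K.lamH / K.gamR) * (M * E) +
          (1 + K.lamB / K.gamR) * (K.c₁ * (M * E) + K.lamQ * (M * E)) := by gcongr
    _ = K.Λb K.lamQ * E := by rw [Constants.Λb, ← hM]; ring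

end IsExtremal

end

/-! ### The Schwarz iteration -/

section

theorem hasGradientAt_quadratic {E : Type*} [NormedAddCommGroup E] [InnerProductSpace ℝ E]
    [CompleteSpace E] {F : E →L[ℝ] E} (hF : ∀ x y, inner ℝ (F x) y = inner ℝ x (F y)) (w z : E) :
    HasGradientAt (fun z => (1 / 2) * inner ℝ z (F z) - inner ℝ z w) (F z - w) z := by
  rw [hasGradientAt_iff_hasFDerivAt]
  have hquad := ((hasFDerivAt_id z).inner ℝ F.hasFDerivAt).const_mul (1 / 2 : ℝ)
  have hlin := (hasFDerivAt_id z).inner ℝ (hasFDerivAt_const w z)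
  refine (hquad.sub hlin).congr_fderiv (ContinuousLinearMap.ext fun y => ?_)
  simp only [id, InnerProductSpace.toDual_apply_apply, sub_apply, smul_apply,
    ContinuousLinearMap.comp_apply, ContinuousLinearMap.prod_apply, fderivInnerCLM_apply,
    ContinuousLinearMap.id_apply, zero_apply, inner_zero_right, inner_sub_left, smul_eq_mul,
    ← hF z y, real_inner_comm (F z) y, real_inner_comm w y]
  ring

namespace Decomposition

variable {T : ℝ} {m : ℕ} (D : Decomposition T m) (j : Fin m)

theorem t_nonneg (i : Fin (m + 1)) : 0 ≤ D.t i :=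
  D.t_zero.symm.trans_le (D.strictMono.monotone (Fin.zero_le i))

theorem t_le (i : Fin (m + 1)) : D.t i ≤ T :=
  (D.strictMono.monotone (Fin.le_last i)).trans_eq D.t_last

theorem t_lt : D.t j.castSucc < D.t j.succ := D.strictMono j.castSucc_lt_succ

theorem left_nonneg : 0 ≤ D.left j := le_max_right _ _

theorem left_le : D.left j ≤ D.t j.castSucc :=
  max_le (sub_le_self _ (D.τ₀_pos j).le) (D.t_nonneg _)

theorem le_right : D.t j.succ ≤ D.right j :=
  le_min (le_add_of_nonneg_right (D.τ₁_pos j).le) (D.t_le _)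

theorem right_le : D.right j ≤ T := min_le_right _ _

theorem left_lt_right : D.left j < D.right j :=
  (D.left_le j).trans_lt ((D.t_lt j).trans_le (D.le_right j))

theorem right_mem : D.right j ∈ Icc 0 T :=
  ⟨(D.left_nonneg j).trans (D.left_lt_right j).le, D.right_le j⟩

theorem Icc_t_subset : Icc (D.t j.castSucc) (D.t j.succ) ⊆ Icc (D.left j) (D.right j) :=
  Icc_subset_Icc (D.left_le j) (D.le_right j)

theorem τ_le : D.τ ≤ min (D.τ₀ j) (D.τ₁ j) := ciInf_le (Set.finite_range _).bddBelow j

variable {j}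

theorem right_last (hj : j.succ = Fin.last m) : D.right j = T := by
  rw [right, hj, D.t_last]
  exact min_eq_right (le_add_of_nonneg_right (D.τ₁_pos j).le)

theorem left_eq_zero_or_τ_le_sub {t : ℝ} (ht : D.t j.castSucc ≤ t) :
    D.left j = 0 ∨ D.τ ≤ t - D.left j := by
  refine (max_choice (D.t j.castSucc - D.τ₀ j) 0).symm.imp_right fun hleft => ?_
  have hτ := (D.τ_le j).trans (min_le_left _ _)
  rw [left, hleft]
  linarith

theorem τ_le_right_sub (hτ : D.t j.succ + D.τ ≤ T) {t : ℝ} (ht : t ≤ D.t j.succ) :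
    D.τ ≤ D.right j - t := by
  have hright : D.t j.succ + D.τ ≤ D.right j :=
    le_min (add_le_add_right ((D.τ_le j).trans (min_le_right _ _)) _) hτ
  linarith

variable (j)

theorem cell_subset : D.cell j ⊆ Icc (D.t j.castSucc) (D.t j.succ) := by
  rw [cell]
  split_ifs
  exacts [subset_rfl, Ico_subset_Icc_self]

theorem left_mem_cell : D.t j.castSucc ∈ D.cell j := by
  rw [cell]
  split_ifs
  exacts [left_mem_Icc.2 (D.t_lt j).le, left_mem_Ico.2 (D.t_lt j)]

end Decomposition

variable {nx nu m : ℕ} {P : Problem nx nu} {K : Constants} {D : Decomposition P.T m}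

theorem IsSchwarzRun.initial {x : ℕ → ℝ → Vec nx} {u : ℕ → ℝ → Vec nu} {lam : ℕ → ℝ → Vec nx}
    {xs : ℕ → Fin m → ℝ → Vec nx} {us : ℕ → Fin m → ℝ → Vec nu} {lams : ℕ → Fin m → ℝ → Vec nx}
    (hrun : IsSchwarzRun P D x u lam xs us lams) (hm : 0 < m) (k : ℕ) : x k 0 = P.x₀ := by
  induction k with
  | zero => exact hrun.init
  | succ k ih =>
    let j : Fin m := ⟨0, hm⟩
    have ht : D.t j.castSucc = 0 := D.t_zero
    have hleft : D.left j = 0 := le_antisymm (ht ▸ D.left_le j) (D.left_nonneg j)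
    have hsub := (hrun.solve k j).admissible.initial (D.left_lt_right j).le
    rw [hleft, ih] at hsub
    rw [(hrun.aggregate k j 0 (ht ▸ D.left_mem_cell j)).1, hsub]

theorem Coercive.terminalWeight_QT (hcoer : Coercive P K) : TerminalWeight K P.QT :=
  have hlower := smul_one_le_iff.1 hcoer.lowerQT
  ⟨hlower.1, hlower.2, inner_le_of_le_smul_one hcoer.upperQT⟩

theorem Regular.terminalWeight_Q (h : Regular P K) (t : ℝ) : TerminalWeight K (P.Q t) :=
  ⟨h.inner_Q_symm t, h.le_inner_Q t, h.inner_Q_le t⟩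

theorem Constants.Positive.Λb_nonneg (hK : K.Positive) : 0 ≤ K.Λb K.lamQ := by
  have := hK.lamH_pos
  have := hK.gamR_pos
  have := hK.lamB_pos
  have := hK.c₁_pos
  have := hK.lamQ_pos
  have := hK.cZ_pos
  rw [Constants.Λb]
  positivity

theorem Constants.Positive.exp_neg_ρZ_mul_le (hK : K.Positive) {r s : ℝ} (hrs : r ≤ s) :
    Real.exp (-K.ρZ * s) ≤ Real.exp (-K.ρZ * r) :=
  Real.exp_le_exp.2 (mul_le_mul_of_nonpos_left hrs (neg_nonpos.2 hK.ρZ_pos.le))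

theorem hasGradientAt_fullTerminalCost (hQT : ∀ x y, inner ℝ (P.QT x) y = inner ℝ x (P.QT y))
    (z : Vec nx) : HasGradientAt (fullTerminalCost P) (P.QT z) z := by
  have hgrad := hasGradientAt_quadratic hQT 0 z
  simp only [inner_zero_right, sub_zero] at hgrad
  exact hgrad

theorem subTerminalCost_last {j : Fin m} (hj : j.succ = Fin.last m) (q : Vec nx) :
    subTerminalCost P D j q = fullTerminalCost P :=
  funext fun _ => if_pos hj

theorem subTerminalCost_of_ne_last {j : Fin m} (hj : j.succ ≠ Fin.last m) (q : Vec nx) :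
    subTerminalCost P D j q =
      fun z => (1 / 2) * inner ℝ z (P.Q (D.right j) z) - inner ℝ z (P.Q (D.right j) q) :=
  funext fun _ => if_neg hj

namespace IsSubSolution

variable {j : Fin m} {x lam y mu xStar lamStar : ℝ → Vec nx} {v uStar : ℝ → Vec nu}
  {p q : Vec nx} {t : ℝ}

theorem defect_right_last (hsub : IsSubSolution P D j p q y v mu)
    (hstar : IsFullSolution P xStar uStar lamStar) (hQT : TerminalWeight K P.QT)
    (hj : j.succ = Fin.last m) :
    mu (D.right j) - lamStar (D.right j) - P.QT (y (D.right j) - xStar (D.right j)) = 0 := by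
  have hend := hsub.adjoint_end
  have hstar_end := hstar.adjoint_end
  rw [subTerminalCost_last hj] at hend
  rw [← D.right_last hj] at hstar_end
  rw [hend.unique (hasGradientAt_fullTerminalCost hQT.symm _),
    hstar_end.unique (hasGradientAt_fullTerminalCost hQT.symm _), map_sub, sub_self]

theorem norm_defect_right_le (hcoer : Coercive P K) (hQ : TerminalWeight K (P.Q (D.right j)))
    (hsub : IsSubSolution P D j p
      (x (D.right j) - (P.Q (D.right j)).inverse (lam (D.right j))) y v mu)
    (hj : j.succ ≠ Fin.last m) :
    ‖mu (D.right j) - lamStar (D.right j) - P.Q (D.right j) (y (D.right j) - xStar (D.right j))‖ ≤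
      K.lamQ * (‖x (D.right j) - xStar (D.right j)‖ +
        1 / K.gamQ * ‖lam (D.right j) - lamStar (D.right j)‖) := by
  have hend := hsub.adjoint_end
  rw [subTerminalCost_of_ne_last hj] at hend
  have hmu := hend.unique (hasGradientAt_quadratic hQ.symm _ _)
  rw [map_sub, (isInvertible_of_le_inner hcoer.gamQ_pos hQ.lower).self_apply_inverse] at hmu
  have hlamQ : 0 < K.lamQ := hcoer.gamQ_pos.trans_le hcoer.gamQ_le
  have hnormQ : ‖P.Q (D.right j)‖ ≤ K.lamQ := norm_le_of_inner_le hlamQ.le hQ.symm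
    (fun z => (mul_nonneg hcoer.gamQ_pos.le (sq_nonneg _)).trans (hQ.lower z)) hQ.upper
  have hratio : 1 ≤ K.lamQ * (1 / K.gamQ) := by
    rw [mul_one_div]
    exact (one_le_div hcoer.gamQ_pos).2 hcoer.gamQ_le
  generalize D.right j = b at *
  calc ‖mu b - lamStar b - P.Q b (y b - xStar b)‖
      = ‖(lam b - lamStar b) - P.Q b (x b - xStar b)‖ := by
        rw [hmu]
        simp only [map_sub]
        abel_nf
    _ ≤ ‖lam b - lamStar b‖ + ‖P.Q b (x b - xStar b)‖ := norm_sub_le _ _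
    _ ≤ K.lamQ * (1 / K.gamQ) * ‖lam b - lamStar b‖ + K.lamQ * ‖x b - xStar b‖ :=
        add_le_add (le_mul_of_one_le_left (norm_nonneg _) hratio)
          ((P.Q b).le_of_opNorm_le hnormQ _)
    _ = _ := by ring

theorem error_le_of_defect_le (hbdd : BoundedMatrices P K) (hucc : UniformlyControllable P K)
    (hcoer : Coercive P K) (hstar : IsFullSolution P xStar uStar lamStar) (hx₀ : x 0 = P.x₀)
    (hsub : IsSubSolution P D j (x (D.left j)) q y v mu) {G : Vec nx →L[ℝ] Vec nx}
    (hG : TerminalWeight K G) {δ : ℝ}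
    (hδ : ‖mu (D.right j) - lamStar (D.right j) - G (y (D.right j) - xStar (D.right j))‖ ≤
      K.lamQ * δ) (ht : t ∈ Icc (D.t j.castSucc) (D.t j.succ)) :
    ‖y t - xStar t‖ + ‖v t - uStar t‖ + ‖mu t - lamStar t‖ ≤
      K.Λb K.lamQ * (Real.exp (-K.ρZ * D.τ) * ‖x (D.left j) - xStar (D.left j)‖ +
        Real.exp (-K.ρZ * (D.right j - t)) * δ) := by
  have hT : 0 < P.T := hucc.σ_pos.trans hucc.σ_lt
  have h := Problem.regular_extend hbdd hcoer hucc hT.le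
  have hW := hucc.gramianBounds_extend hT.le
  have hlr := D.left_lt_right j
  have hleft := D.left_nonneg j
  have hright := D.right_le j
  have hfull : IsExtremal (P.extend hT.le) 0 P.T xStar uStar lamStar :=
    (hstar.extend le_rfl hT.le le_rfl).isExtremal h hT
  have hpart : IsExtremal (P.extend hT.le) (D.left j) (D.right j) y v mu :=
    (hsub.extend hleft hlr.le hright).isExtremal h hlr
  have herror := (hpart.sub (hfull.mono hleft hright)).norm_add_norm_add_norm_le h hW hleft
    hright hG hδ (D.Icc_t_subset j ht)
  rw [hsub.admissible.initial hlr.le] at herror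
  have hdecay : Real.exp (-K.ρZ * (t - D.left j)) * ‖x (D.left j) - xStar (D.left j)‖ ≤
      Real.exp (-K.ρZ * D.τ) * ‖x (D.left j) - xStar (D.left j)‖ := by
    rcases D.left_eq_zero_or_τ_le_sub ht.1 with hzero | hτ
    · rw [hzero, hx₀, hstar.admissible.initial hT.le, sub_self, norm_zero, mul_zero, mul_zero]
    · exact mul_le_mul_of_nonneg_right (h.exp_neg_ρZ_mul_le hτ) (norm_nonneg _)
  exact herror.trans (mul_le_mul_of_nonneg_left (add_le_add_left hdecay _) h.Λb_nonneg)

theorem error_le_last (hbdd : BoundedMatrices P K) (hucc : UniformlyControllable P K)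
    (hcoer : Coercive P K) (hstar : IsFullSolution P xStar uStar lamStar) (hx₀ : x 0 = P.x₀)
    (hsub : IsSubSolution P D j (x (D.left j)) q y v mu) (hj : j.succ = Fin.last m)
    (ht : t ∈ Icc (D.t j.castSucc) (D.t j.succ)) :
    ‖y t - xStar t‖ + ‖v t - uStar t‖ + ‖mu t - lamStar t‖ ≤
      K.c * Real.exp (-K.ρZ * D.τ) * boundaryError D j x lam xStar lamStar := by
  have hQT := hcoer.terminalWeight_QT
  have hT : 0 ≤ P.T := (hucc.σ_pos.trans hucc.σ_lt).le
  have hΛ := (Problem.regular_extend hbdd hcoer hucc hT).Λb_nonneg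
  have hγ : 0 < 1 / K.gamQ := one_div_pos.2 hcoer.gamQ_pos
  have herror := hsub.error_le_of_defect_le hbdd hucc hcoer hstar hx₀ hQT (δ := 0)
    (by rw [hsub.defect_right_last hstar hQT hj, norm_zero, mul_zero]) ht
  rw [mul_zero, add_zero] at herror
  rw [Constants.c, boundaryError, if_pos hj, add_zero]
  calc _ ≤ _ := herror
    _ ≤ K.Λb K.lamQ * (Real.exp (-K.ρZ * D.τ) * ‖x (D.left j) - xStar (D.left j)‖) *
        (1 + 1 / K.gamQ) := le_mul_of_one_le_right (by positivity) (by linarith)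
    _ = _ := by ring

theorem error_le_of_ne_last (hbdd : BoundedMatrices P K) (hucc : UniformlyControllable P K)
    (hcoer : Coercive P K) (hstar : IsFullSolution P xStar uStar lamStar) (hx₀ : x 0 = P.x₀)
    (hsub : IsSubSolution P D j (x (D.left j))
      (x (D.right j) - (P.Q (D.right j)).inverse (lam (D.right j))) y v mu)
    (hj : j.succ ≠ Fin.last m) (hτ : D.t j.succ + D.τ ≤ P.T)
    (ht : t ∈ Icc (D.t j.castSucc) (D.t j.succ)) :
    ‖y t - xStar t‖ + ‖v t - uStar t‖ + ‖mu t - lamStar t‖ ≤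
      K.c * Real.exp (-K.ρZ * D.τ) * boundaryError D j x lam xStar lamStar := by
  have hT : 0 ≤ P.T := (hucc.σ_pos.trans hucc.σ_lt).le
  have h := Problem.regular_extend hbdd hcoer hucc hT
  have hΛ := h.Λb_nonneg
  have hγ : 0 < 1 / K.gamQ := one_div_pos.2 hcoer.gamQ_pos
  have hQ : TerminalWeight K (P.Q (D.right j)) :=
    Problem.extend_Q (hT := hT) (D.right_mem j) ▸ h.terminalWeight_Q (D.right j)
  have herror := hsub.error_le_of_defect_le hbdd hucc hcoer hstar hx₀ hQ
    (hsub.norm_defect_right_le hcoer hQ hj) ht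
  have hdecay := h.exp_neg_ρZ_mul_le (D.τ_le_right_sub hτ ht.2)
  rw [Constants.c, boundaryError, if_neg hj]
  set e₀ := ‖x (D.left j) - xStar (D.left j)‖
  set e₁ := ‖x (D.right j) - xStar (D.right j)‖
  set e₂ := ‖lam (D.right j) - lamStar (D.right j)‖
  have he₀ : 0 ≤ e₀ := norm_nonneg _
  have he₁ : 0 ≤ e₁ := norm_nonneg _
  have : 0 ≤ e₂ := norm_nonneg _
  calc _ ≤ _ := herror
    _ ≤ K.Λb K.lamQ * (Real.exp (-K.ρZ * D.τ) * ((1 + 1 / K.gamQ) * e₀) +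
        Real.exp (-K.ρZ * D.τ) * ((1 + 1 / K.gamQ) * e₁ + (1 + 1 / K.gamQ) * e₂)) := by
        gcongr
        · exact le_mul_of_one_le_left he₀ (by linarith)
        · exact le_mul_of_one_le_left he₁ (by linarith)
        · linarith
    _ = _ := by ring

end IsSubSolution

end

end Schwarz

end

theorem mainTheorem2 {nx nu m : ℕ} (P : Schwarz.Problem nx nu) (K : Schwarz.Constants)
    (hbdd : Schwarz.BoundedMatrices P K) (hucc : Schwarz.UniformlyControllable P K)
    (hcoer : Schwarz.Coercive P K)
    (D : Schwarz.Decomposition P.T m)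
    (xStar : ℝ → Schwarz.Vec nx) (uStar : ℝ → Schwarz.Vec nu) (lamStar : ℝ → Schwarz.Vec nx)
    (hstar : Schwarz.IsFullSolution P xStar uStar lamStar)
    (x : ℕ → ℝ → Schwarz.Vec nx) (u : ℕ → ℝ → Schwarz.Vec nu) (lam : ℕ → ℝ → Schwarz.Vec nx)
    (xs : ℕ → Fin m → ℝ → Schwarz.Vec nx) (us : ℕ → Fin m → ℝ → Schwarz.Vec nu)
    (lams : ℕ → Fin m → ℝ → Schwarz.Vec nx)
    (hrun : Schwarz.IsSchwarzRun P D x u lam xs us lams)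
    (k : ℕ) (hk : 1 ≤ k) (j : Fin m)
    (hτ : j.succ ≠ Fin.last m → D.t j.succ + D.τ ≤ P.T) :
    (∀ t ∈ Set.Icc (D.t j.castSucc) (D.t j.succ),
      ‖xs k j t - xStar t‖ + ‖us k j t - uStar t‖ + ‖lams k j t - lamStar t‖ ≤
        K.c * Real.exp (-K.ρZ * D.τ) *
          Schwarz.boundaryError D j (x (k - 1)) (lam (k - 1)) xStar lamStar) ∧
    (∀ t ∈ D.cell j,
      ‖x k t - xStar t‖ + ‖u k t - uStar t‖ + ‖lam k t - lamStar t‖ ≤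
        K.c * Real.exp (-K.ρZ * D.τ) *
          Schwarz.boundaryError D j (x (k - 1)) (lam (k - 1)) xStar lamStar) := by
  obtain ⟨k, rfl⟩ := Nat.exists_eq_add_of_le' hk
  have hcell : ∀ t ∈ Set.Icc (D.t j.castSucc) (D.t j.succ),
      ‖xs (k + 1) j t - xStar t‖ + ‖us (k + 1) j t - uStar t‖ + ‖lams (k + 1) j t - lamStar t‖ ≤
        K.c * Real.exp (-K.ρZ * D.τ) *
          Schwarz.boundaryError D j (x k) (lam k) xStar lamStar := fun t ht => by
    have hsub := hrun.solve k j
    have hinit := hrun.initial j.pos k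
    by_cases hj : j.succ = Fin.last m
    · exact hsub.error_le_last hbdd hucc hcoer hstar hinit hj ht
    · exact hsub.error_le_of_ne_last hbdd hucc hcoer hstar hinit hj (hτ hj) ht
  refine ⟨hcell, fun t ht => ?_⟩
  obtain ⟨hx, hu, hlam⟩ := hrun.aggregate k j t ht
  rw [hx, hu, hlam]
  exact hcell t (D.cell_subset j ht)
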